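/- Let $M=\ell^\infty(\mathbb Z,\mathbb R)\times\ell^\infty(\mathbb Z,\mathbb R)$ with norm $\|(a,b)\|_M=\max(\|a\|_\infty,\|b\|_\infty)$. For every initial condition in $M$ the Toda equations $$\dot a_n=a_n(b_{n+1}-b_n),\qquad \dot b_n=2(a_n^2-a_{n-1}^2),\qquad n\in\mathbb Z,$$ have a unique global solution (a differentiable curve $\mathbb R\to M$); let $\Phi_t:M\to M$ denote the resulting flow. For ${\rm x}=(a,b)\in M$ let $L({\rm x})$ be the bounded operator on $\ell^2(\mathbb Z)$ given by $[L({\rm x})f]_n=a_nf_{n+1}+a_{n-1}f_{n-1}+b_nf_n$, and write $\|L({\rm x})\|_2$ for its operator norm. For a function $A:M\to\mathbb C$ put $\|A\|_{\rm x}=\sup_{t\in\mathbb R}|A(\Phi_t({\rm x}))|$ and $\alpha_t(A)=A\circ\Phi_t$. Let $\mathcal A^{(1)}$ be the set of all $A:M\to\mathbb C$ whose partial derivatives $\partial A/\partial a_n,\ \partial A/\partial b_n$ ($n\in\mathbb Z$) exist at every point of $M$ and satisfy, for every ${\rm x}\in M$, $\|\partial A/\partial a_n\|_{\rm x}<\infty$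 and $\|\partial A/\partial b_n\|_{\rm x}<\infty$ for all $n$, and $\sum_{n\in\mathbb Z}\big(\|\partial A/\partial a_n\|_{\rm x}+\|\partial A/\partial b_n\|_{\rm x}\big)<\infty$. The modified Poisson bracket is $$\{A,B\}({\rm x})=\frac14\sum_{n\in\mathbb Z}a_n\left[\frac{\partial A}{\partial a_n}\frac{\partial B}{\partial\tilde b_n}-\frac{\partial A}{\partial\tilde b_n}\frac{\partial B}{\partial a_n}\right]({\rm x}),\qquad \frac{\partial}{\partial\tilde b_n}=\frac{\partial}{\partial b_{n+1}}-\frac{\partial}{\partial b_n}.$$ **Theorem (Lieb–Robinson bound for the Toda lattice).** Let ${\rm x}=(a,b)\in M$ and $\mu>0$, and set $$C=\frac{2}{\sqrt{17}}\,(1+e^{\mu}),\qquad v=(1+\sqrt{17})\,\|L({\rm x})\|_2\left(e^{\mu+1}+\frac1\mu\right).$$ Then for all $A,B\in\mathcal A^{(1)}$ with $A$ Fréchet differentiable on $M$, and all $t\in\mathbb R$, the first order partial derivatives of $\alpha_t(A)$ exist at ${\rm x}$, the series defining $\{\alpha_t(A),B\}({\rm x})$ converges absolutely, and $$|\{\alpha_t(A),B\}({\rm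 x})|\le C\,\|a\|_\infty\sum_{n,m\in\mathbb Z}\left(\left\|\frac{\partial A}{\partial a_m}\right\|_{\rm x}+\left\|\frac{\partial A}{\partial b_m}\right\|_{\rm x}\right)\left(\left\|\frac{\partial B}{\partial a_n}\right\|_{\rm x}+\left\|\frac{\partial B}{\partial b_n}\right\|_{\rm x}\right)e^{-\mu\left(|n-m|-v|t|\right)},$$ where the double series on the right converges. -/

import Mathlib

open scoped ENNReal

noncomputable section

namespace Toda

/-- The space `ℓ^∞(ℤ, ℝ)` of bounded real sequences with the supremum norm. -/
abbrev BddSeq : Type := lp (fun _ : ℤ => ℝ) ∞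

/-- The phase space `M = ℓ^∞(ℤ, ℝ) × ℓ^∞(ℤ, ℝ)` of pairs `x = (a, b)`, with the norm
`max (‖a‖_∞) (‖b‖_∞)`. -/
abbrev Phase : Type := BddSeq × BddSeq

/-- The complex Hilbert space `ℓ²(ℤ)`. -/
abbrev Ell2 : Type := lp (fun _ : ℤ => ℂ) 2

/-- The translated sequence `n ↦ c (n + k)`. -/
def shift (k : ℤ) (c : BddSeq) : BddSeq :=
  ⟨fun n => c (n + k), memℓp_infty ⟨‖c‖, by
    rintro _ ⟨n, rfl⟩
    exact lp.norm_apply_le_norm ENNReal.top_ne_zero c (n + k)⟩⟩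

theorem shift_apply (k : ℤ) (c : BddSeq) (n : ℤ) : shift k c n = c (n + k) := rfl

/-! ### The Toda equations and the Toda flow -/

/-- The Toda vector field on `M`; see `todaField_fst` and `todaField_snd` for its coordinates. -/
def todaField (x : Phase) : Phase :=
  (x.1 * (shift 1 x.2 - x.2), (2 : ℝ) • (x.1 * x.1 - shift (-1) (x.1 * x.1)))

theorem todaField_fst (x : Phase) (n : ℤ) :
    (todaField x).1 n = x.1 n * (x.2 (n + 1) - x.2 n) := rfl

theorem todaField_snd (x : Phase) (n : ℤ) :
    (todaField x).2 n = 2 * (x.1 n ^ 2 - x.1 (n - 1) ^ 2) := by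
  rw [pow_two, pow_two]; rfl

/-- `γ` is a global solution in `M` of the Toda equations `a_n' = a_n (b_{n+1} - b_n)`,
`b_n' = 2 (a_n² - a_{n-1}²)` with initial condition `x`. -/
def IsTodaSolution (x : Phase) (γ : ℝ → Phase) : Prop :=
  γ 0 = x ∧ ∀ t : ℝ, HasDerivAt γ (todaField (γ t)) t

/-- The Toda flow `Φ_t`: the value at time `t` of the global solution started at `x`. -/
def todaFlow (t : ℝ) (x : Phase) : Phase :=
  Classical.epsilon (fun γ : ℝ → Phase => IsTodaSolution x γ) t

/-! ### The operator `L(x)` on `ℓ²(ℤ)` -/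

theorem memℓp_mulShift (c : BddSeq) (k : ℤ) (f : Ell2) :
    Memℓp (fun n : ℤ => c n • f (n + k)) 2 := by
  apply memℓp_gen
  have hf := (lp.memℓp f).summable (by norm_num)
  have hf' := ((Equiv.addRight k).summable_iff.mpr hf).mul_left (‖c‖ ^ (2 : ℝ≥0∞).toReal)
  refine Summable.of_nonneg_of_le (fun n => by positivity) (fun n => ?_) hf'
  rw [norm_smul, Real.mul_rpow (norm_nonneg _) (norm_nonneg _)]
  have hc := lp.norm_apply_le_norm ENNReal.top_ne_zero c n
  exact mul_le_mul_of_nonneg_right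
    (Real.rpow_le_rpow (norm_nonneg _) hc (by positivity)) (by positivity)

/-- The bounded operator `f ↦ (n ↦ c_n f_{n+k})` on `ℓ²(ℤ)`. -/
def mulShift (c : BddSeq) (k : ℤ) : Ell2 →L[ℂ] Ell2 :=
  LinearMap.mkContinuous
    { toFun := fun f => ⟨fun n => c n • f (n + k), memℓp_mulShift c k f⟩
      map_add' := fun f g => by
        ext n
        exact smul_add (c n) (f (n + k)) (g (n + k))
      map_smul' := fun z f => by
        ext n
        exact smul_comm (c n) z (f (n + k)) }
    ‖c‖ (fun f => by
      have h2 : 0 < (2 : ℝ≥0∞).toReal := by norm_num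
      refine lp.norm_le_of_tsum_le h2 (by positivity) ?_
      have hf := (Equiv.addRight k).summable_iff.mpr ((lp.memℓp f).summable h2)
      rw [Real.mul_rpow (norm_nonneg _) (norm_nonneg _), lp.norm_rpow_eq_tsum h2 f,
        ← (Equiv.addRight k).tsum_eq (fun n => ‖f n‖ ^ (2 : ℝ≥0∞).toReal), ← tsum_mul_left]
      refine Summable.tsum_le_tsum (fun n => ?_)
        ((memℓp_mulShift c k f).summable h2) (hf.mul_left _)
      change ‖c n • f (n + k)‖ ^ (2 : ℝ≥0∞).toReal ≤ _
      rw [norm_smul, Real.mul_rpow (norm_nonneg _) (norm_nonneg _)]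
      have hc := lp.norm_apply_le_norm ENNReal.top_ne_zero c n
      exact mul_le_mul_of_nonneg_right
        (Real.rpow_le_rpow (norm_nonneg _) hc h2.le) (by positivity))

/-- The bounded operator `L(x)` on `ℓ²(ℤ)`; see `laxL_apply` for the formula. -/
def laxL (x : Phase) : Ell2 →L[ℂ] Ell2 :=
  mulShift x.1 1 + mulShift (shift (-1) x.1) (-1) + mulShift x.2 0

theorem laxL_apply (x : Phase) (f : Ell2) (n : ℤ) :
    laxL x f n = x.1 n * f (n + 1) + x.1 (n - 1) * f (n - 1) + x.2 n * f n := by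
  change x.1 n • f (n + 1) + x.1 (n - 1) • f (n - 1) + x.2 n • f (n + 0) = _
  rw [add_zero]
  simp only [Complex.real_smul]

/-! ### Observables -/

/-- The coordinate direction of `a_n` in `M`. -/
def dirA (n : ℤ) : Phase := (lp.single ∞ n (1 : ℝ), 0)

/-- The coordinate direction of `b_n` in `M`. -/
def dirB (n : ℤ) : Phase := (0, lp.single ∞ n (1 : ℝ))

/-- The partial derivative `∂A/∂a_n` at `x`. -/
def partialA (n : ℤ) (A : Phase → ℂ) (x : Phase) : ℂ := lineDeriv ℝ A x (dirA n)

/-- The partial derivative `∂A/∂b_n` at `x`. -/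
def partialB (n : ℤ) (A : Phase → ℂ) (x : Phase) : ℂ := lineDeriv ℝ A x (dirB n)

/-- The derivative `∂A/∂b̃_n = ∂A/∂b_{n+1} - ∂A/∂b_n` at `x`. -/
def partialBTilde (n : ℤ) (A : Phase → ℂ) (x : Phase) : ℂ :=
  partialB (n + 1) A x - partialB n A x

/-- All first order partial derivatives of `A` exist at the point `x`. -/
def HasPartialsAt (A : Phase → ℂ) (x : Phase) : Prop :=
  ∀ n : ℤ, LineDifferentiableAt ℝ A x (dirA n) ∧ LineDifferentiableAt ℝ A x (dirB n)

/-- `‖A‖_x = sup_t |A(Φ_t(x))|` is finite for every `x`. -/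
def PointwiseBounded (A : Phase → ℂ) : Prop :=
  ∀ x : Phase, BddAbove (Set.range fun t : ℝ => ‖A (todaFlow t x)‖)

/-- `‖A‖_x = sup_t |A(Φ_t(x))|`. -/
def orbitNorm (A : Phase → ℂ) (x : Phase) : ℝ := ⨆ t : ℝ, ‖A (todaFlow t x)‖

/-- `‖∂A/∂a_n‖_x + ‖∂A/∂b_n‖_x`. -/
def gradNorm (A : Phase → ℂ) (x : Phase) (n : ℤ) : ℝ :=
  orbitNorm (partialA n A) x + orbitNorm (partialB n A) x

/-- The class of observables whose first order partial derivatives exist everywhere, are pointwise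
bounded, and satisfy `∑_n (‖∂A/∂a_n‖_x + ‖∂A/∂b_n‖_x) < ∞` for every `x`. -/
structure IsClassOne (A : Phase → ℂ) : Prop where
  hasPartials : ∀ x : Phase, HasPartialsAt A x
  bounded : ∀ n : ℤ, PointwiseBounded (partialA n A) ∧ PointwiseBounded (partialB n A)
  summable : ∀ x : Phase, Summable (gradNorm A x)

/-- The Toda dynamics `α_t(A) = A ∘ Φ_t`. -/
def todaDynamics (t : ℝ) (A : Phase → ℂ) : Phase → ℂ := A ∘ todaFlow t

/-- The `n`-th term of the series defining the modified Poisson bracket, without the factor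
`1/4`. -/
def bracketTerm (A B : Phase → ℂ) (x : Phase) (n : ℤ) : ℂ :=
  x.1 n * (partialA n A x * partialBTilde n B x - partialBTilde n A x * partialA n B x)

/-- The modified Poisson bracket `{A, B}(x)`. -/
def bracket (A B : Phase → ℂ) (x : Phase) : ℂ := (1 / 4) * ∑' n : ℤ, bracketTerm A B x n

/-! ### The constants -/

/-- The velocity `v(μ, x) = (1 + √17) ‖L(x)‖ (e^{μ+1} + 1/μ)`. -/
def velocity (μ : ℝ) (x : Phase) : ℝ :=
  (1 + Real.sqrt 17) * ‖laxL x‖ * (Real.exp (μ + 1) + 1 / μ)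

/-- The constant `C(μ) = (2/√17) (1 + e^μ)`. -/
def lrConst (μ : ℝ) : ℝ := 2 / Real.sqrt 17 * (1 + Real.exp μ)

/-- The term with indices `p = (n, m)` of the double series in the Lieb–Robinson bound. -/
def lrTerm (μ v : ℝ) (A B : Phase → ℂ) (x : Phase) (t : ℝ) (p : ℤ × ℤ) : ℝ :=
  gradNorm A x p.2 * gradNorm B x p.1 *
    Real.exp (-μ * (|(p.1 : ℝ) - (p.2 : ℝ)| - v * |t|))

end Toda

end

open scoped ENNReal

noncomputable section

namespace Toda

open Set Filter Topology

/-! ### Grönwall's inequality and Lax equations -/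

/-! The Toda equations are a Lax equation `L' = [P, L]` with `P` skew-adjoint, so `‖L‖` is conserved
(`norm_eq_of_lax`, `norm_laxL_eq`). As `‖x‖ ≤ ‖L(x)‖`, orbits stay bounded, which gives global
existence and Lipschitz constants valid for all time.

The vector field is quadratic, so the difference of two orbits solves exactly a linear equation with
coefficients at their midpoint (`todaField_sub`). Difference quotients of the flow are therefore
Cauchy, and the flow has directional derivatives (`exists_tendsto_diffQuot`).

The linear equation couples only neighbouring sites. Grönwall's inequality in a norm with weight
`exp (μ |k - n|)`, truncated to remain bounded, shows that a perturbation at site `n` has size at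
most a constant times `exp (-μ (|n - m| - v |t|))` at site `m` (`norm_weighted_todaLin_le`,
`linearizedFlow_le`). This decay makes the derivative of the flow a norm-convergent sum of
coordinate directions, so the Fréchet derivative of `A` can be applied termwise
(`norm_fderiv_linearizedFlow_le`). Inserting the result in the bracket and reindexing its neighbour
terms gives the bound. -/

/-- Two-sided form of Grönwall's inequality. -/
theorem norm_le_gronwallBound_abs {E : Type*} [NormedAddCommGroup E] [NormedSpace ℝ E]
    {f f' : ℝ → E} {T K ε : ℝ} (hf : ∀ t ∈ Ioo (-T) T, HasDerivAt f (f' t) t)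
    (bound : ∀ t ∈ Ioo (-T) T, ‖f' t‖ ≤ K * ‖f t‖ + ε) {t : ℝ} (ht : t ∈ Ioo (-T) T) :
    ‖f t‖ ≤ gronwallBound ‖f 0‖ K ε |t| := by
  obtain ⟨h1, h2⟩ := ht
  rcases le_total 0 t with h0 | h0
  · have hsub : ∀ s ∈ Icc 0 t, s ∈ Ioo (-T) T := fun s hs =>
      ⟨by linarith [hs.1], by linarith [hs.2]⟩
    have := norm_le_gronwallBound_of_norm_deriv_right_le (f := f) (f' := f') (a := 0) (b := t)
      (fun s hs => (hf s (hsub s hs)).continuousAt.continuousWithinAt)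
      (fun s hs => (hf s (hsub s ⟨hs.1, hs.2.le⟩)).hasDerivWithinAt) le_rfl
      (fun s hs => bound s (hsub s ⟨hs.1, hs.2.le⟩)) t ⟨h0, le_rfl⟩
    rw [sub_zero] at this
    rwa [abs_of_nonneg h0]
  · have hsub : ∀ s ∈ Icc 0 (-t), -s ∈ Ioo (-T) T := fun s hs =>
      ⟨by linarith [hs.2], by linarith [hs.1]⟩
    have hd : ∀ s ∈ Icc 0 (-t), HasDerivAt (fun s => f (-s)) (-f' (-s)) s := fun s hs => by
      have := (hf (-s) (hsub s hs)).scomp s (hasDerivAt_neg s)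
      rwa [neg_one_smul] at this
    have := norm_le_gronwallBound_of_norm_deriv_right_le (f := fun s => f (-s))
      (f' := fun s => -f' (-s)) (a := 0) (b := -t) (δ := ‖f 0‖) (K := K) (ε := ε)
      (fun s hs => (hd s hs).continuousAt.continuousWithinAt)
      (fun s hs => (hd s ⟨hs.1, hs.2.le⟩).hasDerivWithinAt) (by simp)
      (fun s hs => by
        rw [norm_neg]
        exact bound (-s) (hsub s ⟨hs.1, hs.2.le⟩)) (-t) ⟨by linarith, le_rfl⟩
    rw [sub_zero, neg_neg] at this
    rwa [abs_of_nonpos h0]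

section Isospectral

variable {𝔸 : Type*} [NormedRing 𝔸] [StarRing 𝔸] [CStarRing 𝔸] [NormedAlgebra ℝ 𝔸]
  [StarModule ℝ 𝔸] [NormOneClass 𝔸]

/-- By skewness the linear terms of `star (1 + hP) * (1 + hP)` cancel: `1 + hP` is unitary up to
second order, and the C*-identity turns this into a norm bound. -/
theorem norm_one_add_smul_sq_le {P : 𝔸} (hP : star P = -P) (h : ℝ) :
    ‖1 + h • P‖ ^ 2 ≤ 1 + h ^ 2 * ‖P‖ ^ 2 := by
  have h1 : star (1 + h • P) * (1 + h • P) = 1 - h ^ 2 • (P * P) := by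
    rw [star_add, star_one, star_smul, hP, star_trivial]
    simp only [mul_add, add_mul, one_mul, mul_one, smul_neg, neg_mul, smul_mul_smul_comm, pow_two]
    abel
  rw [pow_two, ← CStarRing.norm_star_mul_self, h1]
  calc ‖1 - h ^ 2 • (P * P)‖ ≤ ‖(1 : 𝔸)‖ + ‖h ^ 2 • (P * P)‖ := norm_sub_le _ _
    _ ≤ 1 + h ^ 2 * ‖P‖ ^ 2 := by
      rw [norm_one, norm_smul, Real.norm_of_nonneg (sq_nonneg h), pow_two ‖P‖]
      gcongr
      exact norm_mul_le _ _

theorem norm_conj_le {P : 𝔸} (hP : star P = -P) (A : 𝔸) (h : ℝ) :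
    ‖(1 + h • P) * A * (1 - h • P)‖ ≤ (1 + h ^ 2 * ‖P‖ ^ 2) * ‖A‖ := by
  have h1 := norm_one_add_smul_sq_le hP h
  have h2 := norm_one_add_smul_sq_le hP (-h)
  rw [neg_smul, ← sub_eq_add_neg, neg_sq] at h2
  calc _ ≤ ‖1 + h • P‖ * ‖A‖ * ‖1 - h • P‖ :=
        (norm_mul_le _ _).trans (by gcongr; exact norm_mul_le _ _)
    _ = (‖1 + h • P‖ * ‖1 - h • P‖) * ‖A‖ := by ring
    _ ≤ _ := by
      gcongr
      nlinarith [sq_nonneg (‖1 + h • P‖ - ‖1 - h • P‖)]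

/-- To first order `A` moves by conjugation with the almost unitary `1 + hP`, so the upper right
derivative of `‖A‖` is at most `0`. No unitary propagator has to be constructed. -/
theorem norm_le_of_lax {A P : ℝ → 𝔸} {a b : ℝ} (hab : a ≤ b)
    (hA : ∀ t ∈ Icc a b, HasDerivAt A (P t * A t - A t * P t) t)
    (hP : ∀ t, star (P t) = -P t) : ‖A b‖ ≤ ‖A a‖ := by
  have key := le_gronwallBound_of_liminf_deriv_right_le (f := fun t => ‖A t‖) (f' := fun _ => 0)
    (δ := ‖A a‖) (K := 0) (ε := 0) (a := a) (b := b)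
    (fun t ht => (hA t ht).continuousAt.norm.continuousWithinAt) ?_ le_rfl (by simp) b ⟨hab, le_rfl⟩
  · simpa [gronwallBound_ε0] using key
  intro t ht r hr
  refine Eventually.frequently ?_
  have hlin : HasDerivAt (fun z : ℝ => (z - t) • P t) (P t) t := by
    simpa using ((hasDerivAt_id t).sub_const t).smul_const (P t)
  -- This comparison curve is tangent to `A` at `t`, so their difference is `o(z - t)`.
  have hconj : HasDerivAt (fun z => (1 + (z - t) • P t) * A t * (1 - (z - t) • P t))
      (P t * A t - A t * P t) t := by
    refine (((hlin.const_add 1).mul_const (A t)).mul (hlin.const_sub 1)).congr_deriv ?_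
    simp [sub_eq_add_neg]
  have hg := ((hA t ⟨ht.1, ht.2.le⟩).sub hconj)
  rw [sub_self] at hg
  have hslope := (hasDerivAt_iff_tendsto_slope.1 hg).norm
  rw [norm_zero] at hslope
  have hslope' : Tendsto (fun z => ‖slope (A - fun z => (1 + (z - t) • P t) * A t *
      (1 - (z - t) • P t)) t z‖ + (z - t) * (‖P t‖ ^ 2 * ‖A t‖)) (𝓝[>] t) (𝓝 (0 + 0)) := by
    refine (hslope.mono_left (nhdsWithin_mono _ fun z hz => ne_of_gt hz)).add ?_
    refine Tendsto.mono_left ?_ nhdsWithin_le_nhds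
    have : Continuous fun z : ℝ => (z - t) * (‖P t‖ ^ 2 * ‖A t‖) := by fun_prop
    simpa using this.tendsto t
  rw [add_zero] at hslope'
  filter_upwards [hslope'.eventually_lt_const hr, self_mem_nhdsWithin] with z hz hzt
  have hpos : 0 < z - t := sub_pos.2 hzt
  refine lt_of_le_of_lt ?_ hz
  have hn := norm_conj_le (hP t) (A t) (z - t)
  have htri := norm_add_le (A z - (1 + (z - t) • P t) * A t * (1 - (z - t) • P t))
    ((1 + (z - t) • P t) * A t * (1 - (z - t) • P t))
  rw [sub_add_cancel] at htri
  have : ‖slope (A - fun z => (1 + (z - t) • P t) * A t * (1 - (z - t) • P t)) t z‖ =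
      (z - t)⁻¹ * ‖A z - (1 + (z - t) • P t) * A t * (1 - (z - t) • P t)‖ := by
    rw [slope_def_module, norm_smul, norm_inv, Real.norm_of_nonneg hpos.le]
    simp
  rw [this, ← sub_nonneg]
  have : (z - t)⁻¹ * ‖A z - (1 + (z - t) • P t) * A t * (1 - (z - t) • P t)‖ +
      (z - t) * (‖P t‖ ^ 2 * ‖A t‖) - (z - t)⁻¹ * (‖A z‖ - ‖A t‖) =
      (z - t)⁻¹ * (‖A z - (1 + (z - t) • P t) * A t * (1 - (z - t) • P t)‖ +
        (1 + (z - t) ^ 2 * ‖P t‖ ^ 2) * ‖A t‖ - ‖A z‖) := by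
    field_simp
    ring
  rw [this]
  exact mul_nonneg (inv_nonneg.2 hpos.le) (by linarith)

/-- The norm is constant along solutions of a Lax equation `A' = [P, A]` with `P` skew-adjoint. -/
theorem norm_eq_of_lax {A P : ℝ → 𝔸} {T : ℝ}
    (hA : ∀ t ∈ Ioo (-T) T, HasDerivAt A (P t * A t - A t * P t) t)
    (hP : ∀ t, star (P t) = -P t) {t : ℝ} (ht : t ∈ Ioo (-T) T) : ‖A t‖ = ‖A 0‖ := by
  have mono : ∀ a b, a ≤ b → -T < a → b < T → ‖A b‖ ≤ ‖A a‖ := fun a b hab ha hb =>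
    norm_le_of_lax hab (fun s hs => hA s ⟨ha.trans_le hs.1, hs.2.trans_lt hb⟩) hP
  have anti : ∀ a b, a ≤ b → -T < a → b < T → ‖A a‖ ≤ ‖A b‖ := fun a b hab ha hb => by
    -- Time reversal gives a Lax equation again, with `P` negated.
    have := norm_le_of_lax (A := fun s => A (-s)) (P := fun s => -P (-s)) (neg_le_neg hab)
      (fun s hs => ?_) (fun s => by rw [star_neg, hP])
    · simpa using this
    · have hs' : -s ∈ Ioo (-T) T := ⟨by linarith [hs.2], by linarith [hs.1]⟩
      refine ((hA (-s) hs').scomp s (hasDerivAt_neg s)).congr_deriv ?_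
      rw [neg_one_smul, neg_mul, mul_neg]
      abel
  obtain ⟨h1, h2⟩ := ht
  rcases le_total 0 t with h | h
  · exact le_antisymm (mono _ _ h (by linarith) h2) (anti _ _ h (by linarith) h2)
  · exact le_antisymm (anti _ _ h h1 (by linarith)) (mono _ _ h h1 (by linarith))

end Isospectral

/-! ### Elementary properties of the phase space -/

theorem abs_apply_le (c : BddSeq) (n : ℤ) : |c n| ≤ ‖c‖ :=
  lp.norm_apply_le_norm ENNReal.top_ne_zero c n

theorem norm_shift_le (k : ℤ) (c : BddSeq) : ‖shift k c‖ ≤ ‖c‖ :=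
  lp.norm_le_of_forall_le (norm_nonneg c) fun n => abs_apply_le c (n + k)

theorem BddSeq.add_apply (c d : BddSeq) (n : ℤ) : (c + d) n = c n + d n := rfl

theorem BddSeq.sub_apply (c d : BddSeq) (n : ℤ) : (c - d) n = c n - d n := rfl

theorem BddSeq.smul_apply (r : ℝ) (c : BddSeq) (n : ℤ) : (r • c) n = r * c n := rfl

theorem phase_ext {x y : Phase} (h1 : ∀ n, x.1 n = y.1 n) (h2 : ∀ n, x.2 n = y.2 n) : x = y :=
  Prod.ext (lp.ext (funext h1)) (lp.ext (funext h2))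

theorem phase_norm_le {x : Phase} {C : ℝ} (hC : 0 ≤ C) (h1 : ∀ n, |x.1 n| ≤ C)
    (h2 : ∀ n, |x.2 n| ≤ C) : ‖x‖ ≤ C :=
  norm_prod_le_iff.2 ⟨lp.norm_le_of_forall_le hC h1, lp.norm_le_of_forall_le hC h2⟩

theorem abs_fst_apply_le (x : Phase) (n : ℤ) : |x.1 n| ≤ ‖x‖ :=
  (abs_apply_le x.1 n).trans (norm_fst_le x)

theorem abs_snd_apply_le (x : Phase) (n : ℤ) : |x.2 n| ≤ ‖x‖ :=
  (abs_apply_le x.2 n).trans (norm_snd_le x)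

/-- The linearization of the Toda vector field at `m`, applied to `v`. -/
def todaLin (m v : Phase) : Phase :=
  (v.1 * (shift 1 m.2 - m.2) + m.1 * (shift 1 v.2 - v.2),
    (4 : ℝ) • (m.1 * v.1 - shift (-1) (m.1 * v.1)))

theorem todaLin_fst (m v : Phase) (n : ℤ) : (todaLin m v).1 n =
    v.1 n * (m.2 (n + 1) - m.2 n) + m.1 n * (v.2 (n + 1) - v.2 n) := rfl

theorem todaLin_snd (m v : Phase) (n : ℤ) : (todaLin m v).2 n =
    4 * (m.1 n * v.1 n - m.1 (n - 1) * v.1 (n - 1)) := rfl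

/-- For a quadratic map the increment is the derivative at the midpoint, with no remainder. -/
theorem todaField_sub (x y : Phase) :
    todaField y - todaField x = todaLin ((1 / 2 : ℝ) • (x + y)) (y - x) := by
  refine phase_ext (fun n => ?_) (fun n => ?_)
  · simp only [Prod.fst_sub, BddSeq.sub_apply, todaField_fst, todaLin_fst, Prod.smul_fst,
      Prod.smul_snd, Prod.snd_sub, Prod.fst_add, Prod.snd_add, BddSeq.smul_apply, BddSeq.add_apply]
    ring
  · simp only [Prod.snd_sub, BddSeq.sub_apply, todaField_snd, todaLin_snd, Prod.smul_fst,
      Prod.fst_sub, Prod.fst_add, BddSeq.smul_apply, BddSeq.add_apply]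
    ring

theorem todaLin_smul (m v : Phase) (r : ℝ) : todaLin m (r • v) = r • todaLin m v := by
  refine phase_ext (fun n => ?_) (fun n => ?_)
  · simp only [todaLin_fst, Prod.smul_fst, Prod.smul_snd, BddSeq.smul_apply]
    ring
  · simp only [todaLin_snd, Prod.smul_fst, Prod.smul_snd, BddSeq.smul_apply]
    ring

theorem todaLin_sub (m m' v v' : Phase) :
    todaLin m v - todaLin m' v' = todaLin m (v - v') + todaLin (m - m') v' := by
  refine phase_ext (fun n => ?_) (fun n => ?_)
  · simp only [todaLin_fst, Prod.fst_sub, Prod.snd_sub, BddSeq.sub_apply, Prod.fst_add,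
      BddSeq.add_apply]
    ring
  · simp only [todaLin_snd, Prod.fst_sub, Prod.snd_sub, BddSeq.sub_apply, Prod.snd_add,
      BddSeq.add_apply]
    ring

theorem norm_todaLin_le (m v : Phase) : ‖todaLin m v‖ ≤ 8 * ‖m‖ * ‖v‖ := by
  have hm := norm_nonneg m
  have hv := norm_nonneg v
  have hmv : 0 ≤ ‖m‖ * ‖v‖ := by positivity
  refine phase_norm_le (by positivity) (fun n => ?_) (fun n => ?_)
  · rw [todaLin_fst]
    calc _ ≤ |v.1 n| * (|m.2 (n + 1)| + |m.2 n|) + |m.1 n| * (|v.2 (n + 1)| + |v.2 n|) := by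
          refine (abs_add_le _ _).trans ?_
          rw [abs_mul, abs_mul]
          gcongr <;> exact abs_sub _ _
      _ ≤ ‖v‖ * (‖m‖ + ‖m‖) + ‖m‖ * (‖v‖ + ‖v‖) := by
          gcongr <;> first | exact abs_fst_apply_le _ _ | exact abs_snd_apply_le _ _
      _ ≤ _ := by nlinarith
  · rw [todaLin_snd, abs_mul]
    calc _ ≤ |(4 : ℝ)| * (|m.1 n| * |v.1 n| + |m.1 (n - 1)| * |v.1 (n - 1)|) := by
          gcongr
          rw [← abs_mul, ← abs_mul]
          exact abs_sub _ _
      _ ≤ 4 * (‖m‖ * ‖v‖ + ‖m‖ * ‖v‖) := by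
          rw [abs_of_pos (by norm_num : (0 : ℝ) < 4)]
          gcongr <;> exact abs_fst_apply_le _ _
      _ = _ := by ring

theorem todaField_zero : todaField 0 = 0 := by
  refine phase_ext (fun n => ?_) (fun n => ?_)
  · rw [todaField_fst]; simp
  · rw [todaField_snd]; simp

theorem norm_half_smul_add_le {x y : Phase} {ρ : ℝ} (hx : ‖x‖ ≤ ρ) (hy : ‖y‖ ≤ ρ) :
    ‖(1 / 2 : ℝ) • (x + y)‖ ≤ ρ := by
  rw [norm_smul, Real.norm_of_nonneg (by norm_num)]
  linarith [norm_add_le x y]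

theorem norm_todaField_sub_le {x y : Phase} {ρ : ℝ} (hx : ‖x‖ ≤ ρ) (hy : ‖y‖ ≤ ρ) :
    ‖todaField y - todaField x‖ ≤ 8 * ρ * ‖y - x‖ := by
  rw [todaField_sub]
  refine (norm_todaLin_le _ _).trans ?_
  gcongr
  exact norm_half_smul_add_le hx hy

theorem norm_todaField_le {x : Phase} {ρ : ℝ} (hx : ‖x‖ ≤ ρ) : ‖todaField x‖ ≤ 8 * ρ * ρ := by
  have hρ : 0 ≤ ρ := (norm_nonneg x).trans hx
  have := norm_todaField_sub_le (x := 0) (by simpa using hρ) hx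
  rw [todaField_zero, sub_zero, sub_zero] at this
  exact this.trans (by gcongr)

/-! ### The Lax pair -/

theorem mulShift_apply (c : BddSeq) (k : ℤ) (f : Ell2) (n : ℤ) :
    mulShift c k f n = c n * f (n + k) := by
  change c n • f (n + k) = _
  rw [Complex.real_smul]

theorem norm_mulShift_le (c : BddSeq) (k : ℤ) : ‖mulShift c k‖ ≤ ‖c‖ :=
  LinearMap.mkContinuous_norm_le _ (norm_nonneg c) _

/-- `laxL` as a bounded real linear map. -/
def laxCLM : Phase →L[ℝ] (Ell2 →L[ℂ] Ell2) :=
  LinearMap.mkContinuous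
    { toFun := laxL
      map_add' := fun x y => by
        ext f n
        change laxL _ f n = laxL x f n + laxL y f n
        simp only [laxL_apply, Prod.fst_add, Prod.snd_add, BddSeq.add_apply, Complex.ofReal_add]
        ring
      map_smul' := fun r x => by
        ext f n
        change laxL _ f n = r • laxL x f n
        simp only [laxL_apply, Prod.smul_fst, Prod.smul_snd, BddSeq.smul_apply, Complex.ofReal_mul,
          Complex.real_smul]
        ring }
    3 (fun x => by
      have h1 := (norm_mulShift_le x.1 1).trans (norm_fst_le x)
      have h2 := ((norm_mulShift_le (shift (-1) x.1) (-1)).trans (norm_shift_le _ _)).trans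
        (norm_fst_le x)
      have h3 := (norm_mulShift_le x.2 0).trans (norm_snd_le x)
      have := norm_add₃_le (a := mulShift x.1 1) (b := mulShift (shift (-1) x.1) (-1))
        (c := mulShift x.2 0)
      change ‖mulShift x.1 1 + mulShift (shift (-1) x.1) (-1) + mulShift x.2 0‖ ≤ _
      linarith)

theorem laxCLM_apply (x : Phase) : laxCLM x = laxL x := rfl

/-- The skew-adjoint operator `P(x)` of the Toda Lax pair. -/
def laxP (x : Phase) : Ell2 →L[ℂ] Ell2 :=
  mulShift x.1 1 - mulShift (shift (-1) x.1) (-1)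

theorem laxP_apply (x : Phase) (f : Ell2) (n : ℤ) :
    laxP x f n = x.1 n * f (n + 1) - x.1 (n - 1) * f (n - 1) := by
  change mulShift x.1 1 f n - mulShift (shift (-1) x.1) (-1) f n = _
  rw [mulShift_apply, mulShift_apply]
  rfl

theorem adjoint_mulShift (c : BddSeq) (k : ℤ) :
    ContinuousLinearMap.adjoint (mulShift c k) = mulShift (shift (-k) c) (-k) := by
  symm
  rw [ContinuousLinearMap.eq_adjoint_iff]
  intro f g
  rw [lp.inner_eq_tsum, lp.inner_eq_tsum, ← (Equiv.addRight k).tsum_eq]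
  refine tsum_congr fun n => ?_
  simp only [Equiv.coe_addRight, mulShift_apply, shift_apply, add_neg_cancel_right]
  simp only [RCLike.inner_apply, map_mul, Complex.conj_ofReal]
  ring

theorem star_laxP (x : Phase) : star (laxP x) = -laxP x := by
  rw [ContinuousLinearMap.star_eq_adjoint, laxP, map_sub, adjoint_mulShift, adjoint_mulShift,
    neg_sub, neg_neg]
  congr 2
  ext n
  simp [shift_apply]

/-- The second off-diagonals of the commutator cancel; the remaining bands are the Toda equations.
-/
theorem laxL_todaField (x : Phase) :
    laxL (todaField x) = laxP x * laxL x - laxL x * laxP x := by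
  ext f n
  change laxL (todaField x) f n = laxP x (laxL x f) n - laxL x (laxP x f) n
  simp only [laxL_apply, laxP_apply, todaField_fst, todaField_snd, add_sub_cancel_right,
    sub_add_cancel]
  push_cast
  ring

theorem abs_fst_le_norm_laxL (x : Phase) (n : ℤ) : |x.1 n| ≤ ‖laxL x‖ := by
  have h1 := (lp.norm_apply_le_norm (by norm_num) (laxL x (lp.single 2 (n + 1) 1)) n).trans
    ((laxL x).le_opNorm _)
  rw [lp.norm_single (by norm_num), laxL_apply, lp.single_apply_self,
    lp.single_apply_ne _ _ _ (by lia), lp.single_apply_ne _ _ _ (by lia)] at h1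
  simpa using h1

theorem abs_snd_le_norm_laxL (x : Phase) (n : ℤ) : |x.2 n| ≤ ‖laxL x‖ := by
  have h1 := (lp.norm_apply_le_norm (by norm_num) (laxL x (lp.single 2 n 1)) n).trans
    ((laxL x).le_opNorm _)
  rw [lp.norm_single (by norm_num), laxL_apply, lp.single_apply_self,
    lp.single_apply_ne _ _ _ (by lia), lp.single_apply_ne _ _ _ (by lia)] at h1
  simpa using h1

/-- The coordinates are matrix entries of `L(x)`. This turns conservation of `‖L‖` into an a priori
bound on orbits. -/
theorem norm_le_norm_laxL (x : Phase) : ‖x‖ ≤ ‖laxL x‖ :=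
  phase_norm_le (norm_nonneg _) (abs_fst_le_norm_laxL x) (abs_snd_le_norm_laxL x)

instance : Nontrivial Ell2 :=
  ⟨⟨lp.single 2 0 1, 0, fun h => by
    have h0 := congrArg (fun f : Ell2 => f 0) h
    simp at h0⟩⟩

instance : StarModule ℝ (Ell2 →L[ℂ] Ell2) :=
  ⟨fun r A => by
    have h : ∀ B : Ell2 →L[ℂ] Ell2, r • B = (r : ℂ) • B := fun B => by
      ext f n
      exact (Complex.real_smul (x := r) (z := B f n))
    rw [h, star_smul, star_trivial r, h, Complex.star_def, Complex.conj_ofReal]⟩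

/-- The norm of `L` is conserved along the Toda flow, also after a change of time scale. -/
theorem norm_laxL_eq {γ : ℝ → Phase} {χ : ℝ → ℝ} {T : ℝ}
    (hγ : ∀ t ∈ Ioo (-T) T, HasDerivAt γ (χ t • todaField (γ t)) t) {t : ℝ}
    (ht : t ∈ Ioo (-T) T) : ‖laxL (γ t)‖ = ‖laxL (γ 0)‖ := by
  -- The real factor `χ` is absorbed into `P`, which stays skew-adjoint.
  refine norm_eq_of_lax (A := fun t => laxL (γ t)) (P := fun t => χ t • laxP (γ t))
    (fun s hs => ?_) (fun s => ?_) ht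
  · refine (laxCLM.hasFDerivAt.comp_hasDerivAt s (hγ s hs)).congr_deriv ?_
    rw [map_smul, laxCLM_apply, laxL_todaField, smul_sub, smul_mul_assoc, mul_smul_comm]
  · rw [star_smul, star_laxP, star_trivial, smul_neg]

/-! ### Existence and uniqueness of the flow -/

/-- A cutoff function: `1` on the ball of radius `R`, `0` outside the ball of radius `R + 1`. -/
def cutoff (R : ℝ) (x : Phase) : ℝ := max 0 (min 1 (R + 1 - ‖x‖))

theorem cutoff_nonneg (R : ℝ) (x : Phase) : 0 ≤ cutoff R x := le_max_left _ _

theorem cutoff_le_one (R : ℝ) (x : Phase) : cutoff R x ≤ 1 :=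
  max_le zero_le_one (min_le_left _ _)

theorem cutoff_eq_one {R : ℝ} {x : Phase} (h : ‖x‖ ≤ R) : cutoff R x = 1 := by
  rw [cutoff, min_eq_left (by linarith), max_eq_right zero_le_one]

theorem cutoff_eq_zero {R : ℝ} {x : Phase} (h : R + 1 ≤ ‖x‖) : cutoff R x = 0 :=
  max_eq_left ((min_le_right _ _).trans (by linarith))

theorem abs_cutoff_sub_le (R : ℝ) (x y : Phase) : |cutoff R x - cutoff R y| ≤ ‖x - y‖ := by
  have h := abs_norm_sub_norm_le x y
  refine (abs_max_sub_max_le_max _ _ _ _).trans (max_le (by simp) ?_)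
  refine (abs_min_sub_min_le_max _ _ _ _).trans (max_le (by simp) ?_)
  rw [show R + 1 - ‖x‖ - (R + 1 - ‖y‖) = -(‖x‖ - ‖y‖) by ring, abs_neg]
  exact h

theorem norm_cutoff_smul_todaField_le {R : ℝ} (hR : 0 ≤ R) (x : Phase) :
    ‖cutoff R x • todaField x‖ ≤ 8 * (R + 1) * (R + 1) := by
  rcases le_total ‖x‖ (R + 1) with h | h
  · rw [norm_smul, Real.norm_of_nonneg (cutoff_nonneg R x)]
    exact (mul_le_of_le_one_left (norm_nonneg _) (cutoff_le_one R x)).trans (norm_todaField_le h)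
  · rw [cutoff_eq_zero h, zero_smul, norm_zero]
    positivity

theorem norm_cutoff_smul_todaField_sub_le {R ρ : ℝ} {x y : Phase} (hx : ‖x‖ ≤ ρ) (hy : ‖y‖ ≤ ρ) :
    ‖cutoff R x • todaField x - cutoff R y • todaField y‖ ≤
      (8 * ρ + 8 * ρ * ρ) * ‖x - y‖ := by
  have e : cutoff R x • todaField x - cutoff R y • todaField y =
      cutoff R x • (todaField x - todaField y) + (cutoff R x - cutoff R y) • todaField y := by
    rw [smul_sub, sub_smul]
    abel
  rw [e]
  refine (norm_add_le _ _).trans ?_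
  rw [norm_smul, norm_smul, Real.norm_of_nonneg (cutoff_nonneg R x), Real.norm_eq_abs]
  calc _ ≤ 1 * (8 * ρ * ‖x - y‖) + ‖x - y‖ * (8 * ρ * ρ) := by
        gcongr
        · exact cutoff_le_one R x
        · exact norm_todaField_sub_le hy hx
        · exact abs_cutoff_sub_le R x y
        · exact norm_todaField_le hy
    _ = _ := by ring

/-- The truncated field is bounded on all of `M`, so Picard–Lindelöf applies on an interval of any
length. Its solution never leaves the region where the cutoff is `1`. -/
theorem exists_todaSolution_Ioo (x : Phase) {T : ℝ} (hT : 0 < T) :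
    ∃ γ : ℝ → Phase, γ 0 = x ∧ ∀ t ∈ Ioo (-T) T, HasDerivAt γ (todaField (γ t)) t := by
  set R := ‖laxL x‖ with hRdef
  have hR : 0 ≤ R := norm_nonneg _
  set M : NNReal := ⟨8 * (R + 1) * (R + 1), by positivity⟩
  -- The farthest a curve of speed at most `M` can travel in time `T`.
  set a : NNReal := M * ⟨T, hT.le⟩
  have hρ : 0 ≤ ‖x‖ + a := by positivity
  have hPL : IsPicardLindelof (fun _ : ℝ => fun y : Phase => cutoff R y • todaField y)
      (tmin := -T) (tmax := T) ⟨0, by constructor <;> linarith⟩ x a 0 M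
      ⟨8 * (‖x‖ + a) + 8 * (‖x‖ + a) * (‖x‖ + a), by positivity⟩ := by
    have hball : ∀ y ∈ Metric.closedBall x a, ‖y‖ ≤ ‖x‖ + a := fun y hy => by
      have := norm_le_norm_add_norm_sub x y
      rw [Metric.mem_closedBall, dist_eq_norm] at hy
      rw [norm_sub_rev] at this
      linarith
    refine IsPicardLindelof.of_time_independent (fun y _ => norm_cutoff_smul_todaField_le hR y)
      (LipschitzOnWith.of_dist_le_mul fun y hy z hz => ?_) ?_
    · rw [dist_eq_norm, dist_eq_norm]
      exact norm_cutoff_smul_todaField_sub_le (hball y hy) (hball z hz)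
    · simp [show (a : ℝ) = M * T from rfl]
  obtain ⟨γ, h0, hγ⟩ := hPL.exists_eq_forall_mem_Icc_hasDerivWithinAt₀
  have hγ' : ∀ t ∈ Ioo (-T) T, HasDerivAt γ (cutoff R (γ t) • todaField (γ t)) t := fun t ht =>
    (hγ t (Ioo_subset_Icc_self ht)).hasDerivAt (Icc_mem_nhds ht.1 ht.2)
  refine ⟨γ, h0, fun t ht => ?_⟩
  -- The cutoff only changes the time scale, so `‖L‖` keeps the value `R` and the norm of `γ t` is
  -- at most `R`.
  have hL := norm_laxL_eq (χ := fun t => cutoff R (γ t)) hγ' ht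
  have h0' : γ 0 = x := h0
  rw [h0', ← hRdef] at hL
  have := hγ' t ht
  rwa [cutoff_eq_one (hL ▸ norm_le_norm_laxL (γ t)), one_smul] at this

theorem norm_laxL_todaSolution {γ : ℝ → Phase} {T : ℝ}
    (hγ : ∀ t ∈ Ioo (-T) T, HasDerivAt γ (todaField (γ t)) t) {t : ℝ} (ht : t ∈ Ioo (-T) T) :
    ‖laxL (γ t)‖ = ‖laxL (γ 0)‖ :=
  norm_laxL_eq (χ := fun _ => 1) (by simpa using hγ) ht

theorem norm_todaSolution_sub_le {γ δ : ℝ → Phase} {T ρ : ℝ}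
    (hγ : ∀ t ∈ Ioo (-T) T, HasDerivAt γ (todaField (γ t)) t)
    (hδ : ∀ t ∈ Ioo (-T) T, HasDerivAt δ (todaField (δ t)) t)
    (h1 : ‖laxL (γ 0)‖ ≤ ρ) (h2 : ‖laxL (δ 0)‖ ≤ ρ) {t : ℝ} (ht : t ∈ Ioo (-T) T) :
    ‖γ t - δ t‖ ≤ ‖γ 0 - δ 0‖ * Real.exp (8 * ρ * |t|) := by
  have := norm_le_gronwallBound_abs (f := fun t => γ t - δ t) (K := 8 * ρ) (ε := 0)
    (fun t ht => (hγ t ht).sub (hδ t ht)) (fun s hs => ?_) ht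
  · rwa [gronwallBound_ε0] at this
  · rw [add_zero]
    refine norm_todaField_sub_le ?_ ?_
    · exact (norm_le_norm_laxL _).trans ((norm_laxL_todaSolution hδ hs).trans_le h2)
    · exact (norm_le_norm_laxL _).trans ((norm_laxL_todaSolution hγ hs).trans_le h1)

theorem todaSolution_unique_Ioo {γ δ : ℝ → Phase} {T : ℝ}
    (hγ : ∀ t ∈ Ioo (-T) T, HasDerivAt γ (todaField (γ t)) t)
    (hδ : ∀ t ∈ Ioo (-T) T, HasDerivAt δ (todaField (δ t)) t)
    (h0 : γ 0 = δ 0) {t : ℝ} (ht : t ∈ Ioo (-T) T) : γ t = δ t := by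
  have := norm_todaSolution_sub_le hγ hδ le_rfl (by rw [h0]) ht
  rw [h0, sub_self, norm_zero, zero_mul] at this
  exact sub_eq_zero.1 (norm_le_zero_iff.1 this)

theorem existsUnique_todaSolution (x : Phase) : ∃! γ : ℝ → Phase, IsTodaSolution x γ := by
  have hex : ∀ T : ℝ, ∃ γ : ℝ → Phase, 0 < T →
      γ 0 = x ∧ ∀ t ∈ Ioo (-T) T, HasDerivAt γ (todaField (γ t)) t := fun T => by
    by_cases hT : 0 < T
    · obtain ⟨γ, h⟩ := exists_todaSolution_Ioo x hT
      exact ⟨γ, fun _ => h⟩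
    · exact ⟨0, fun h => absurd h hT⟩
  choose γ hγ using hex
  have hpos : ∀ t : ℝ, 0 < |t| + 1 := fun t => by positivity
  -- Local solutions on `(-T, T)` are glued by reading the value at `t` from `T = |t| + 1`;
  -- uniqueness on common intervals makes them agree.
  refine ⟨fun t => γ (|t| + 1) t, ⟨(hγ _ (hpos 0)).1, fun t => ?_⟩, fun δ hδ => ?_⟩
  · have hmem : t ∈ Ioo (-(|t| + 1)) (|t| + 1) := abs_lt.1 (by linarith)
    refine ((hγ _ (hpos t)).2 t hmem).congr_of_eventuallyEq ?_
    filter_upwards [Ioo_mem_nhds hmem.1 hmem.2] with s hs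
    have hs' : |s| < |t| + 1 := abs_lt.2 hs
    refine todaSolution_unique_Ioo (T := min (|s| + 1) (|t| + 1))
      (fun r hr => (hγ _ (hpos s)).2 r ?_) (fun r hr => (hγ _ (hpos t)).2 r ?_)
      ((hγ _ (hpos s)).1.trans (hγ _ (hpos t)).1.symm) (abs_lt.1 (lt_min (by linarith) hs'))
    · exact abs_lt.1 ((abs_lt.2 hr).trans_le (min_le_left _ _))
    · exact abs_lt.1 ((abs_lt.2 hr).trans_le (min_le_right _ _))
  · funext t
    exact todaSolution_unique_Ioo (fun r _ => hδ.2 r) (hγ _ (hpos t)).2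
      (hδ.1.trans (hγ _ (hpos t)).1.symm) (abs_lt.1 (by linarith))

theorem isTodaSolution_todaFlow (x : Phase) : IsTodaSolution x fun t => todaFlow t x :=
  Classical.epsilon_spec (existsUnique_todaSolution x).exists

theorem todaFlow_zero (x : Phase) : todaFlow 0 x = x := (isTodaSolution_todaFlow x).1

theorem hasDerivAt_todaFlow (x : Phase) (t : ℝ) :
    HasDerivAt (fun t => todaFlow t x) (todaField (todaFlow t x)) t :=
  (isTodaSolution_todaFlow x).2 t

theorem mem_Ioo_abs_add_one (t : ℝ) : t ∈ Ioo (-(|t| + 1)) (|t| + 1) := abs_lt.1 (by linarith)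

theorem norm_laxL_todaFlow (t : ℝ) (x : Phase) : ‖laxL (todaFlow t x)‖ = ‖laxL x‖ := by
  rw [norm_laxL_todaSolution (γ := fun t => todaFlow t x) (fun s _ => hasDerivAt_todaFlow x s)
    (mem_Ioo_abs_add_one t), todaFlow_zero]

theorem norm_todaFlow_sub_le {x y : Phase} {ρ : ℝ} (hx : ‖laxL x‖ ≤ ρ) (hy : ‖laxL y‖ ≤ ρ)
    (t : ℝ) : ‖todaFlow t x - todaFlow t y‖ ≤ ‖x - y‖ * Real.exp (8 * ρ * |t|) := by
  have := norm_todaSolution_sub_le (γ := fun t => todaFlow t x) (δ := fun t => todaFlow t y)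
    (ρ := ρ) (fun s _ => hasDerivAt_todaFlow x s) (fun s _ => hasDerivAt_todaFlow y s)
    (by rwa [todaFlow_zero]) (by rwa [todaFlow_zero]) (mem_Ioo_abs_add_one t)
  rwa [todaFlow_zero, todaFlow_zero] at this

/-! ### Difference quotients of the flow -/

theorem laxL_add_smul (x e : Phase) (s : ℝ) : laxL (x + s • e) = laxL x + s • laxL e := by
  simp only [← laxCLM_apply, map_add, map_smul]

theorem norm_laxL_add_smul_le (x e : Phase) {s : ℝ} (hs : |s| ≤ 1) :
    ‖laxL (x + s • e)‖ ≤ ‖laxL x‖ + ‖laxL e‖ := by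
  rw [laxL_add_smul]
  refine (norm_add_le _ _).trans ?_
  rw [norm_smul, Real.norm_eq_abs]
  gcongr
  exact mul_le_of_le_one_left (norm_nonneg _) hs

/-- The difference quotient of the Toda flow at `x` in direction `e`. -/
def diffQuot (x e : Phase) (s t : ℝ) : Phase := s⁻¹ • (todaFlow t (x + s • e) - todaFlow t x)

/-- The midpoint of the Toda orbits of `x` and `x + s e`. -/
def midFlow (x e : Phase) (s t : ℝ) : Phase :=
  (1 / 2 : ℝ) • (todaFlow t x + todaFlow t (x + s • e))

theorem diffQuot_zero (x e : Phase) {s : ℝ} (hs : s ≠ 0) : diffQuot x e s 0 = e := by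
  rw [diffQuot, todaFlow_zero, todaFlow_zero, add_sub_cancel_left, inv_smul_smul₀ hs]

theorem hasDerivAt_diffQuot (x e : Phase) (s t : ℝ) :
    HasDerivAt (diffQuot x e s) (todaLin (midFlow x e s t) (diffQuot x e s t)) t := by
  have := ((hasDerivAt_todaFlow (x + s • e) t).sub (hasDerivAt_todaFlow x t)).const_smul s⁻¹
  rwa [todaField_sub, ← todaLin_smul] at this

theorem norm_todaFlow_le (t : ℝ) (x : Phase) : ‖todaFlow t x‖ ≤ ‖laxL x‖ :=
  (norm_le_norm_laxL _).trans (norm_laxL_todaFlow t x).le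

theorem norm_midFlow_le (x e : Phase) (s t : ℝ) :
    ‖midFlow x e s t‖ ≤ max ‖laxL x‖ ‖laxL (x + s • e)‖ :=
  norm_half_smul_add_le ((norm_todaFlow_le t _).trans (le_max_left _ _))
    ((norm_todaFlow_le t _).trans (le_max_right _ _))

theorem norm_midFlow_sub_le (x e : Phase) {s r : ℝ} (hs : |s| ≤ 1) (hr : |r| ≤ 1) (t : ℝ) :
    ‖midFlow x e s t - midFlow x e r t‖ ≤
      |s - r| * (‖e‖ * Real.exp (8 * (‖laxL x‖ + ‖laxL e‖) * |t|)) := by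
  rw [midFlow, midFlow, ← smul_sub, add_sub_add_left_eq_sub, norm_smul,
    Real.norm_of_nonneg (by norm_num)]
  have := norm_todaFlow_sub_le (norm_laxL_add_smul_le x e hs) (norm_laxL_add_smul_le x e hr) t
  rw [add_sub_add_left_eq_sub, ← sub_smul, norm_smul, Real.norm_eq_abs, mul_assoc] at this
  linarith [norm_nonneg (todaFlow t (x + s • e) - todaFlow t (x + r • e))]

theorem norm_diffQuot_le (x e : Phase) {s : ℝ} (h0 : s ≠ 0) (hs : |s| ≤ 1) (t : ℝ) :
    ‖diffQuot x e s t‖ ≤ ‖e‖ * Real.exp (8 * (‖laxL x‖ + ‖laxL e‖) * |t|) := by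
  have hx : ‖laxL x‖ ≤ ‖laxL x‖ + ‖laxL e‖ := by linarith [norm_nonneg (laxL e)]
  have := norm_todaFlow_sub_le (norm_laxL_add_smul_le x e hs) hx t
  rw [add_sub_cancel_left, norm_smul, mul_assoc] at this
  rw [diffQuot, norm_smul, norm_inv, inv_mul_le_iff₀ (norm_pos_iff.2 h0)]
  exact this

theorem gronwallBound_zero_left (K ε x : ℝ) :
    gronwallBound 0 K ε x = ε * gronwallBound 0 K 1 x := by
  by_cases hK : K = 0
  · simp [hK, gronwallBound_K0]
  · simp only [gronwallBound_of_K_ne_0 hK]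
    ring

/-- Two difference quotients start from the same `e`, and their equations differ only through the
midpoints, which are `O(|s - r|)` apart. Grönwall's bound with zero initial value is linear in this
inhomogeneity. -/
theorem exists_norm_diffQuot_sub_le (x e : Phase) (t : ℝ) :
    ∃ C : ℝ, ∀ s r : ℝ, s ≠ 0 → r ≠ 0 → |s| ≤ 1 → |r| ≤ 1 →
      ‖diffQuot x e s t - diffQuot x e r t‖ ≤ |s - r| * C := by
  set ρ := ‖laxL x‖ + ‖laxL e‖ with hρ
  have hρ0 : 0 ≤ ρ := by positivity
  -- Bounds the quotients, and the midpoint differences divided by `|s - r|`, throughout `|τ| < |t|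
  -- + 1`.
  set G := ‖e‖ * Real.exp (8 * ρ * (|t| + 1)) with hG
  refine ⟨8 * G * G * gronwallBound 0 (8 * ρ) 1 |t|, fun s r hs0 hr0 hs hr => ?_⟩
  have key := norm_le_gronwallBound_abs
    (f := fun t => diffQuot x e s t - diffQuot x e r t) (K := 8 * ρ) (ε := |s - r| * (8 * G * G))
    (fun τ _ => (hasDerivAt_diffQuot x e s τ).sub (hasDerivAt_diffQuot x e r τ))
    (fun τ hτ => ?_) (mem_Ioo_abs_add_one t)
  · rw [diffQuot_zero x e hs0, diffQuot_zero x e hr0, sub_self, norm_zero,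
      gronwallBound_zero_left] at key
    rwa [← mul_assoc]
  · have hle : ‖e‖ * Real.exp (8 * ρ * |τ|) ≤ G := by
      rw [hG]
      gcongr
      exact (abs_lt.2 hτ).le
    have h1 : ‖midFlow x e s τ‖ ≤ ρ :=
      (norm_midFlow_le x e s τ).trans (max_le (by rw [hρ]; linarith [norm_nonneg (laxL e)])
        (norm_laxL_add_smul_le x e hs))
    rw [todaLin_sub]
    refine (norm_add_le _ _).trans (add_le_add ?_ ?_)
    · exact (norm_todaLin_le _ _).trans (by gcongr)
    · refine (norm_todaLin_le _ _).trans ?_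
      calc _ ≤ 8 * (|s - r| * G) * G := by
            gcongr
            · exact (norm_midFlow_sub_le x e hs hr τ).trans (by gcongr)
            · exact (norm_diffQuot_le x e hr0 hr τ).trans hle
        _ = _ := by ring

theorem exists_tendsto_diffQuot (x e : Phase) (t : ℝ) :
    ∃ V, Tendsto (fun s => diffQuot x e s t) (𝓝[≠] 0) (𝓝 V) := by
  obtain ⟨C, hC⟩ := exists_norm_diffQuot_sub_le x e t
  refine cauchy_map_iff_exists_tendsto.1 ?_
  rw [cauchy_map_iff]
  refine ⟨inferInstance, ?_⟩
  rw [tendsto_uniformity_iff_dist_tendsto_zero]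
  have hlim : Tendsto (fun p : ℝ × ℝ => |p.1 - p.2| * C) (𝓝[≠] 0 ×ˢ 𝓝[≠] 0) (𝓝 0) := by
    have hcont : Continuous fun p : ℝ × ℝ => |p.1 - p.2| * C := by fun_prop
    have := hcont.tendsto (0, 0)
    rw [nhds_prod_eq] at this
    simpa using this.mono_left (Filter.prod_mono nhdsWithin_le_nhds nhdsWithin_le_nhds)
  have hev : ∀ᶠ s : ℝ in 𝓝[≠] 0, s ≠ 0 ∧ |s| ≤ 1 := by
    filter_upwards [self_mem_nhdsWithin, nhdsWithin_le_nhds (Icc_mem_nhds (a := (-1 : ℝ))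
      (b := 1) (x := 0) (by norm_num) (by norm_num))] with s h1 h2
    exact ⟨h1, abs_le.2 h2⟩
  refine squeeze_zero' (Eventually.of_forall fun _ => dist_nonneg) ?_ hlim
  filter_upwards [hev.prod_mk hev] with p hp
  rw [dist_eq_norm]
  exact hC _ _ hp.1.1 hp.2.1 hp.1.2 hp.2.2

theorem hasLineDerivAt_todaFlow_iff {x e V : Phase} {t : ℝ} :
    HasLineDerivAt ℝ (todaFlow t) V x e ↔
      Tendsto (fun s => diffQuot x e s t) (𝓝[≠] 0) (𝓝 V) := by
  rw [HasLineDerivAt, hasDerivAt_iff_tendsto_slope_zero]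
  simp only [zero_add, zero_smul, add_zero, diffQuot]

/-! ### Exponential localization of the linearized flow -/

/-- The bounded weight `k ↦ exp (μ min (|k - n|, R))`. -/
def weight (μ : ℝ) (hμ : 0 < μ) (n : ℤ) (R : ℝ) : BddSeq :=
  ⟨fun k => Real.exp (μ * min |(k : ℝ) - n| R), memℓp_infty ⟨Real.exp (μ * R), by
    rintro _ ⟨k, rfl⟩
    simp only [Real.norm_eq_abs, Real.abs_exp]
    gcongr
    exact min_le_right _ _⟩⟩

theorem weight_apply (μ : ℝ) (hμ : 0 < μ) (n : ℤ) (R : ℝ) (k : ℤ) :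
    weight μ hμ n R k = Real.exp (μ * min |(k : ℝ) - n| R) := rfl

/-- Truncation at `R` preserves the Lipschitz constant `μ` of the exponent, so the estimates are
uniform in `R`. -/
theorem weight_le (μ : ℝ) (hμ : 0 < μ) (n : ℤ) (R : ℝ) {k l : ℤ} (hkl : |(k : ℝ) - l| ≤ 1) :
    weight μ hμ n R k ≤ Real.exp μ * weight μ hμ n R l := by
  rw [weight_apply, weight_apply, ← Real.exp_add, Real.exp_le_exp]
  have h : min |(k : ℝ) - n| R ≤ 1 + min |(l : ℝ) - n| R := by
    have := abs_sub_le (k : ℝ) l n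
    rcases min_cases |(l : ℝ) - n| R with h | h
    · exact (min_le_left _ _).trans (by linarith)
    · exact (min_le_right _ _).trans (by linarith)
  nlinarith

/-- The exponential rate `1 + √17` of the linearized Toda equations. -/
def todaRate : ℝ := 1 + Real.sqrt 17

/-- The characteristic equation of the matrix `[[2, 2], [8, 0]]`, which bounds the growth of the two
component norms in the unweighted case. -/
theorem todaRate_mul_self : todaRate * todaRate = 2 * todaRate + 16 := by
  have := Real.mul_self_sqrt (show (0 : ℝ) ≤ 17 by norm_num)
  rw [todaRate]
  nlinarith

theorem todaRate_pos : 0 < todaRate := by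
  rw [todaRate]
  positivity

theorem todaRate_le : todaRate ≤ 8 := by
  have : Real.sqrt 17 ≤ 7 := Real.sqrt_le_iff.2 (by norm_num)
  rw [todaRate]
  linarith

/-- Multiplication by a weight, with the second component scaled by `(1 + √17) / 8`. -/
def weighted (w : BddSeq) (x : Phase) : Phase := (w * x.1, (todaRate / 8) • (w * x.2))

theorem weighted_fst (w : BddSeq) (x : Phase) (k : ℤ) : (weighted w x).1 k = w k * x.1 k := rfl

theorem weighted_snd (w : BddSeq) (x : Phase) (k : ℤ) :
    (weighted w x).2 k = todaRate / 8 * (w k * x.2 k) := rfl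

theorem hasDerivAt_weighted (w : BddSeq) {f : ℝ → Phase} {f' : Phase} {t : ℝ}
    (hf : HasDerivAt f f' t) : HasDerivAt (fun t => weighted w (f t)) (weighted w f') t := by
  have h1 : HasDerivAt (fun t => (f t).1) f'.1 t :=
    (ContinuousLinearMap.fst ℝ BddSeq BddSeq).hasFDerivAt.comp_hasDerivAt t hf
  have h2 : HasDerivAt (fun t => (f t).2) f'.2 t :=
    (ContinuousLinearMap.snd ℝ BddSeq BddSeq).hasFDerivAt.comp_hasDerivAt t hf
  exact (h1.const_mul w).prodMk ((h2.const_mul w).const_smul (todaRate / 8))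

/-- With `λ = 1 + √17`, the scale `λ / 8` balances the two components: `2 + 2 * (8 / λ) = λ` and `(λ
/ 8) * 8 = λ`. Each neighbour costs a factor `exp μ`, whence the average `(1 + exp μ) / 2`. -/
theorem norm_weighted_todaLin_le {μ : ℝ} (hμ : 0 < μ) (n : ℤ) (R : ℝ) {N : ℝ} {m : Phase}
    (hm : ‖m‖ ≤ N) (q : Phase) :
    ‖weighted (weight μ hμ n R) (todaLin m q)‖ ≤
      N * todaRate * ((1 + Real.exp μ) / 2) * ‖weighted (weight μ hμ n R) q‖ := by
  set w := weight μ hμ n R with hw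
  set F := ‖weighted w q‖ with hF
  have hN : 0 ≤ N := (norm_nonneg m).trans hm
  have hF0 : 0 ≤ F := norm_nonneg _
  have hl := todaRate_pos
  have hl2 := todaRate_mul_self
  have hwpos : ∀ k, 0 < w k := fun k => Real.exp_pos _
  have hE : 1 ≤ Real.exp μ := Real.one_le_exp hμ.le
  have h1 : ∀ k, w k * |q.1 k| ≤ F := fun k => by
    have := abs_fst_apply_le (weighted w q) k
    rwa [weighted_fst, abs_mul, abs_of_pos (hwpos k)] at this
  -- By the quadratic equation this is `8 / todaRate * F`, written without division.
  obtain ⟨G, hG⟩ : ∃ G, G = (todaRate - 2) / 2 * F := ⟨_, rfl⟩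
  have h2 : ∀ k, w k * |q.2 k| ≤ G := fun k => by
    have := abs_snd_apply_le (weighted w q) k
    rw [weighted_snd, abs_mul, abs_mul, abs_of_pos (hwpos k), abs_of_pos (by positivity)] at this
    have h3 : (todaRate - 2) / 2 * (todaRate / 8 * (w k * |q.2 k|)) = w k * |q.2 k| := by
      linear_combination (w k * |q.2 k|) / 16 * hl2
    rw [← h3, hG]
    gcongr
    nlinarith
  have hwn : ∀ k l : ℤ, |(k : ℝ) - l| ≤ 1 → w k ≤ Real.exp μ * w l := fun k l h =>
    weight_le μ hμ n R h
  have hm1 : ∀ k, |m.1 k| ≤ N := fun k => (abs_fst_apply_le m k).trans hm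
  have hm2 : ∀ k, |m.2 k| ≤ N := fun k => (abs_snd_apply_le m k).trans hm
  have hl3 : 0 ≤ todaRate - 2 := by nlinarith
  refine phase_norm_le (by positivity) (fun k => ?_) (fun k => ?_)
  · rw [weighted_fst, todaLin_fst, abs_mul, abs_of_pos (hwpos k)]
    have hnext : w k * |q.2 (k + 1)| ≤ Real.exp μ * G := by
      calc _ ≤ Real.exp μ * w (k + 1) * |q.2 (k + 1)| := by
            gcongr
            exact hwn _ _ (by push_cast; norm_num)
        _ = Real.exp μ * (w (k + 1) * |q.2 (k + 1)|) := by ring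
        _ ≤ _ := by gcongr; exact h2 _
    calc _ ≤ w k * (|q.1 k| * (|m.2 (k + 1)| + |m.2 k|) +
          |m.1 k| * (|q.2 (k + 1)| + |q.2 k|)) := by
          gcongr
          · exact (hwpos k).le
          refine (abs_add_le _ _).trans ?_
          rw [abs_mul, abs_mul]
          gcongr <;> exact abs_sub _ _
      _ ≤ w k * (|q.1 k| * (N + N) + N * (|q.2 (k + 1)| + |q.2 k|)) := by
          gcongr
          · exact (hwpos k).le
          · exact hm2 _
          · exact hm2 _
          · exact hm1 _
      _ = w k * |q.1 k| * (N + N) + N * (w k * |q.2 (k + 1)| + w k * |q.2 k|) := by ring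
      _ ≤ F * (N + N) + N * (Real.exp μ * G + G) := by
          gcongr
          · exact h1 k
          · exact h2 k
      -- The slack arises because the term in `q.1 k` involves no neighbour of `q.1`.
      _ = N * todaRate * ((1 + Real.exp μ) / 2) * F - N * F * (Real.exp μ - 1) := by
          rw [hG]; ring
      _ ≤ _ := by
          have : 0 ≤ N * F * (Real.exp μ - 1) := mul_nonneg (by positivity) (by linarith)
          linarith
  · rw [weighted_snd, todaLin_snd, abs_mul, abs_mul, abs_mul, abs_of_pos (hwpos k),
      abs_of_pos (by positivity : 0 < todaRate / 8), abs_of_pos (by norm_num : (0 : ℝ) < 4)]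
    have hprev : w k * |q.1 (k - 1)| ≤ Real.exp μ * F := by
      calc _ ≤ Real.exp μ * w (k - 1) * |q.1 (k - 1)| := by
            gcongr
            exact hwn _ _ (by push_cast; norm_num)
        _ = Real.exp μ * (w (k - 1) * |q.1 (k - 1)|) := by ring
        _ ≤ _ := by gcongr; exact h1 _
    calc _ ≤ todaRate / 8 * (w k * (4 * (|m.1 k| * |q.1 k| + |m.1 (k - 1)| * |q.1 (k - 1)|))) := by
          have := (hwpos k).le
          gcongr
          rw [← abs_mul, ← abs_mul]
          exact abs_sub _ _
      _ ≤ todaRate / 8 * (w k * (4 * (N * |q.1 k| + N * |q.1 (k - 1)|))) := by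
          have := (hwpos k).le
          gcongr <;> exact hm1 _
      _ = todaRate / 2 * N * (w k * |q.1 k| + w k * |q.1 (k - 1)|) := by ring
      _ ≤ todaRate / 2 * N * (F + Real.exp μ * F) := by
          gcongr
          exact h1 k
      _ = _ := by ring

/-- Unit vectors supported at a single site `n`. -/
structure IsUnitAt (n : ℤ) (e : Phase) : Prop where
  fst_le : ∀ k, |e.1 k| ≤ if k = n then 1 else 0
  snd_le : ∀ k, |e.2 k| ≤ if k = n then 1 else 0

theorem isUnitAt_dirA (n : ℤ) : IsUnitAt n (dirA n) where
  fst_le k := by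
    change |lp.single (E := fun _ : ℤ => ℝ) ∞ n 1 k| ≤ _
    split_ifs with h
    · subst h; simp
    · rw [lp.single_apply_ne _ _ _ h]; simp
  snd_le k := by
    change |(0 : ℝ)| ≤ _
    split_ifs <;> simp

theorem isUnitAt_dirB (n : ℤ) : IsUnitAt n (dirB n) where
  fst_le k := by
    change |(0 : ℝ)| ≤ _
    split_ifs <;> simp
  snd_le k := by
    change |lp.single (E := fun _ : ℤ => ℝ) ∞ n 1 k| ≤ _
    split_ifs with h
    · subst h; simp
    · rw [lp.single_apply_ne _ _ _ h]; simp

theorem norm_weighted_le_one {μ : ℝ} (hμ : 0 < μ) {n : ℤ} {R : ℝ} (hR : 0 ≤ R) {e : Phase}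
    (he : IsUnitAt n e) : ‖weighted (weight μ hμ n R) e‖ ≤ 1 := by
  have key : ∀ (k : ℤ) (y : ℝ), |y| ≤ (if k = n then 1 else 0) → |weight μ hμ n R k * y| ≤ 1 := by
    intro k y hy
    split_ifs at hy with h
    · subst h
      simpa [weight_apply, hR] using hy
    · simp [abs_nonpos_iff.1 hy]
  refine phase_norm_le zero_le_one (fun k => key k _ (he.fst_le k)) (fun k => ?_)
  rw [weighted_snd, abs_mul, abs_of_pos (by linarith [todaRate_pos])]
  exact mul_le_one₀ (by linarith [todaRate_le]) (abs_nonneg _) (key k _ (he.snd_le k))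

theorem norm_weighted_diffQuot_le {μ : ℝ} (hμ : 0 < μ) {n : ℤ} {R : ℝ} (hR : 0 ≤ R) (x : Phase)
    {e : Phase} (he : IsUnitAt n e) {s : ℝ} (hs : s ≠ 0) (t : ℝ) :
    ‖weighted (weight μ hμ n R) (diffQuot x e s t)‖ ≤
      Real.exp (max ‖laxL x‖ ‖laxL (x + s • e)‖ * todaRate * ((1 + Real.exp μ) / 2) * |t|) := by
  have key := norm_le_gronwallBound_abs (ε := 0)
    (f := fun t => weighted (weight μ hμ n R) (diffQuot x e s t))
    (fun τ _ => hasDerivAt_weighted _ (hasDerivAt_diffQuot x e s τ))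
    (fun τ _ => by
      rw [add_zero]
      exact norm_weighted_todaLin_le hμ n R (norm_midFlow_le x e s τ) _)
    (mem_Ioo_abs_add_one t)
  rw [gronwallBound_ε0, diffQuot_zero x e hs] at key
  exact key.trans (mul_le_of_le_one_left (Real.exp_pos _).le (norm_weighted_le_one hμ hR he))

theorem continuous_weighted (w : BddSeq) : Continuous (weighted w) := by
  unfold weighted
  fun_prop

/-- The rate for finite `s` involves `‖L(x + s e)‖`; continuity of `L` recovers exactly `‖L(x)‖` in
the limit. -/
theorem norm_weighted_le_of_tendsto {μ : ℝ} (hμ : 0 < μ) {n : ℤ} {R : ℝ} (hR : 0 ≤ R) {x : Phase}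
    {e V : Phase} (he : IsUnitAt n e) {t : ℝ}
    (hV : Tendsto (fun s => diffQuot x e s t) (𝓝[≠] 0) (𝓝 V)) :
    ‖weighted (weight μ hμ n R) V‖ ≤
      Real.exp (‖laxL x‖ * todaRate * ((1 + Real.exp μ) / 2) * |t|) := by
  have hcont : Continuous fun s : ℝ => Real.exp (max ‖laxL x‖ ‖laxL x + s • laxL e‖ * todaRate *
      ((1 + Real.exp μ) / 2) * |t|) := by fun_prop
  have hlim := (hcont.tendsto 0).mono_left (nhdsWithin_le_nhds (s := {0}ᶜ))
  rw [zero_smul, add_zero, max_self] at hlim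
  refine le_of_tendsto_of_tendsto (((continuous_weighted _).tendsto V).comp hV).norm hlim ?_
  filter_upwards [self_mem_nhdsWithin] with s hs
  rw [← laxL_add_smul]
  exact norm_weighted_diffQuot_le hμ hR x he hs t

/-- The localization profile `exp (-μ (|n - m| - v |t|))`. -/
def profile (μ : ℝ) (x : Phase) (t : ℝ) (n m : ℤ) : ℝ :=
  Real.exp (-μ * (|(n : ℝ) - (m : ℝ)| - velocity μ x * |t|))

/-- From `1 - μ ≤ exp (-μ)` one gets `exp μ ≤ 1 + μ exp μ`, so the Grönwall rate is below `μ v`. -/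
theorem rate_le_velocity {μ : ℝ} (hμ : 0 < μ) (x : Phase) (t : ℝ) :
    ‖laxL x‖ * todaRate * ((1 + Real.exp μ) / 2) * |t| ≤ μ * (velocity μ x * |t|) := by
  have h1 : Real.exp μ - 1 ≤ μ * Real.exp μ := by
    have := Real.add_one_le_exp (-μ)
    have h2 : Real.exp (-μ) * Real.exp μ = 1 := by rw [← Real.exp_add]; simp
    nlinarith [Real.exp_pos μ]
  have h2 : Real.exp μ ≤ Real.exp (μ + 1) := Real.exp_le_exp.2 (by linarith)
  have h3 : (1 + Real.exp μ) / 2 ≤ μ * (Real.exp (μ + 1) + 1 / μ) := by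
    have : μ * (Real.exp (μ + 1) + 1 / μ) = μ * Real.exp (μ + 1) + 1 := by field_simp
    rw [this]
    nlinarith [mul_le_mul_of_nonneg_left h2 hμ.le, Real.exp_pos μ]
  have h4 : 0 ≤ ‖laxL x‖ * todaRate := mul_nonneg (norm_nonneg _) todaRate_pos.le
  calc _ ≤ ‖laxL x‖ * todaRate * (μ * (Real.exp (μ + 1) + 1 / μ)) * |t| := by gcongr
    _ = _ := by rw [velocity, todaRate]; ring

theorem linearizedFlow_le {μ : ℝ} (hμ : 0 < μ) {n : ℤ} {x e V : Phase} (he : IsUnitAt n e) {t : ℝ}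
    (hV : HasLineDerivAt ℝ (todaFlow t) V x e) (m : ℤ) :
    |V.1 m| ≤ 8 / todaRate * profile μ x t n m ∧ |V.2 m| ≤ 8 / todaRate * profile μ x t n m := by
  -- Truncating at `R = |m - n|` leaves the full weight at site `m`.
  have h := norm_weighted_le_of_tendsto hμ (abs_nonneg ((m : ℝ) - n)) he
    (hasLineDerivAt_todaFlow_iff.1 hV)
  replace h := h.trans (Real.exp_le_exp.2 (rate_le_velocity hμ x t))
  have hw : weight μ hμ n |(m : ℝ) - n| m = Real.exp (μ * |(n : ℝ) - m|) := by
    rw [weight_apply, min_self, abs_sub_comm]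
  have hp : profile μ x t n m =
      (Real.exp (μ * |(n : ℝ) - m|))⁻¹ * Real.exp (μ * (velocity μ x * |t|)) := by
    rw [profile, ← Real.exp_neg, ← Real.exp_add]
    congr 1
    ring
  have h1 := (abs_fst_apply_le _ m).trans h
  have h2 := (abs_snd_apply_le _ m).trans h
  have hl := todaRate_pos
  rw [weighted_fst, hw, abs_mul, Real.abs_exp, ← le_inv_mul_iff₀ (Real.exp_pos _), ← hp] at h1
  rw [weighted_snd, hw, abs_mul, abs_mul, Real.abs_exp, abs_of_pos (by positivity),
    ← le_inv_mul_iff₀ (by positivity), ← le_inv_mul_iff₀ (Real.exp_pos _), mul_left_comm, ← hp,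
    inv_div] at h2
  refine ⟨h1.trans (le_mul_of_one_le_left (Real.exp_pos _).le ?_), h2⟩
  rw [one_le_div hl]
  exact todaRate_le

/-! ### Summation of the localization profile -/

theorem summable_exp_neg_abs {μ : ℝ} (hμ : 0 < μ) (n : ℤ) :
    Summable fun m : ℤ => Real.exp (-μ * |(n : ℝ) - m|) := by
  have h0 : Summable fun k : ℕ => Real.exp (-μ * k) := by
    have := summable_geometric_of_lt_one (Real.exp_pos (-μ)).le (Real.exp_lt_one_iff.2 (by linarith))
    refine this.congr fun k => ?_
    rw [← Real.exp_nat_mul, mul_comm]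
  have h1 : Summable fun m : ℤ => Real.exp (-μ * |(m : ℝ)|) :=
    Summable.of_nat_of_neg (by simpa using h0) (by simpa using h0)
  refine ((Equiv.subLeft n).summable_iff.2 h1).congr fun m => ?_
  simp

theorem profile_eq (μ : ℝ) (x : Phase) (t : ℝ) (n m : ℤ) : profile μ x t n m =
    Real.exp (-μ * |(n : ℝ) - m|) * Real.exp (μ * (velocity μ x * |t|)) := by
  rw [profile, ← Real.exp_add]
  congr 1
  ring

theorem profile_pos (μ : ℝ) (x : Phase) (t : ℝ) (n m : ℤ) : 0 < profile μ x t n m :=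
  Real.exp_pos _

theorem summable_profile {μ : ℝ} (hμ : 0 < μ) (x : Phase) (t : ℝ) (n : ℤ) :
    Summable (profile μ x t n) :=
  ((summable_exp_neg_abs hμ n).mul_right _).congr fun m => (profile_eq μ x t n m).symm

theorem profile_le {μ : ℝ} (hμ : 0 < μ) (x : Phase) (t : ℝ) (n m : ℤ) :
    profile μ x t n m ≤ Real.exp (μ * (velocity μ x * |t|)) := by
  rw [profile_eq]
  refine mul_le_of_le_one_left (Real.exp_pos _).le (Real.exp_le_one_iff.2 ?_)
  nlinarith [abs_nonneg ((n : ℝ) - m)]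

theorem profile_le_exp_mul {μ : ℝ} (hμ : 0 < μ) (x : Phase) (t : ℝ) {n k : ℤ}
    (hnk : |(n : ℝ) - k| ≤ 1) (m : ℤ) :
    profile μ x t n m ≤ Real.exp μ * profile μ x t k m := by
  rw [profile, profile, ← Real.exp_add, Real.exp_le_exp]
  have := abs_sub_le (k : ℝ) n m
  rw [abs_sub_comm (k : ℝ) n] at this
  nlinarith

/-! ### The chain rule along the flow -/

theorem norm_dirA (n : ℤ) : ‖dirA n‖ = 1 := by
  simp [dirA, lp.norm_single]

theorem norm_dirB (n : ℤ) : ‖dirB n‖ = 1 := by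
  simp [dirB, lp.norm_single]

/-- A point of `M` with absolutely summable coordinates is the sum of its coordinates. -/
theorem hasSum_dirA_add_dirB {V : Phase} (h1 : Summable fun m => |V.1 m|)
    (h2 : Summable fun m => |V.2 m|) :
    HasSum (fun m => V.1 m • dirA m + V.2 m • dirB m) V := by
  have hs : Summable fun m => V.1 m • dirA m + V.2 m • dirB m := by
    refine Summable.add (Summable.of_norm ?_) (Summable.of_norm ?_)
    · simpa [norm_smul, norm_dirA] using h1
    · simpa [norm_smul, norm_dirB] using h2
  have key : ∀ (ev : Phase →L[ℝ] ℝ) (k : ℤ),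
      (∀ m, m ≠ k → ev (V.1 m • dirA m + V.2 m • dirB m) = 0) →
      ev (∑' m, (V.1 m • dirA m + V.2 m • dirB m)) = ev (V.1 k • dirA k + V.2 k • dirB k) :=
    fun ev k hk => by rw [ev.map_tsum hs, tsum_eq_single k hk]
  have hA : ∀ m k : ℤ, (V.1 m • dirA m + V.2 m • dirB m).1 k =
      V.1 m * lp.single (E := fun _ : ℤ => ℝ) ∞ m 1 k := fun m k => by
    simp [dirA, dirB]
  have hB : ∀ m k : ℤ, (V.1 m • dirA m + V.2 m • dirB m).2 k =
      V.2 m * lp.single (E := fun _ : ℤ => ℝ) ∞ m 1 k := fun m k => by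
    simp [dirA, dirB]
  have e : ∑' m, (V.1 m • dirA m + V.2 m • dirB m) = V := by
    refine phase_ext (fun k => ?_) (fun k => ?_)
    · refine (key ((lp.evalCLM ℝ (fun _ : ℤ => ℝ) ∞ k).comp (ContinuousLinearMap.fst ℝ _ _)) k
        (fun m hm => (hA m k).trans ?_)).trans ((hA k k).trans ?_)
      · rw [lp.single_apply_ne _ _ _ hm.symm, mul_zero]
      · rw [lp.single_apply_self, mul_one]
    · refine (key ((lp.evalCLM ℝ (fun _ : ℤ => ℝ) ∞ k).comp (ContinuousLinearMap.snd ℝ _ _)) k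
        (fun m hm => (hB m k).trans ?_)).trans ((hB k k).trans ?_)
      · rw [lp.single_apply_ne _ _ _ hm.symm, mul_zero]
      · rw [lp.single_apply_self, mul_one]
  have := hs.hasSum
  rwa [e] at this

theorem norm_todaFlow_le_orbitNorm {f : Phase → ℂ} (hf : PointwiseBounded f) (x : Phase) (t : ℝ) :
    ‖f (todaFlow t x)‖ ≤ orbitNorm f x :=
  le_ciSup (hf x) t

theorem norm_le_orbitNorm {f : Phase → ℂ} (hf : PointwiseBounded f) (x : Phase) :
    ‖f x‖ ≤ orbitNorm f x := by
  have := norm_todaFlow_le_orbitNorm hf x 0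
  rwa [todaFlow_zero] at this

theorem orbitNorm_nonneg (f : Phase → ℂ) (x : Phase) : 0 ≤ orbitNorm f x :=
  Real.iSup_nonneg fun _ => norm_nonneg _

theorem gradNorm_nonneg (A : Phase → ℂ) (x : Phase) (n : ℤ) : 0 ≤ gradNorm A x n :=
  add_nonneg (orbitNorm_nonneg _ _) (orbitNorm_nonneg _ _)

/-- The gradient of `A` smeared out by the localization profile. -/
def smearedGrad (μ : ℝ) (A : Phase → ℂ) (x : Phase) (t : ℝ) (n : ℤ) : ℝ :=
  ∑' m, gradNorm A x m * profile μ x t n m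

theorem summable_gradNorm_mul_profile {μ : ℝ} (hμ : 0 < μ) {A : Phase → ℂ} (hA : IsClassOne A)
    (x : Phase) (t : ℝ) (n : ℤ) : Summable fun m => gradNorm A x m * profile μ x t n m :=
  Summable.of_nonneg_of_le
    (fun m => mul_nonneg (gradNorm_nonneg A x m) (profile_pos μ x t n m).le)
    (fun m => mul_le_mul_of_nonneg_left (profile_le hμ x t n m) (gradNorm_nonneg A x m))
    ((hA.summable x).mul_right _)

theorem smearedGrad_nonneg (μ : ℝ) (A : Phase → ℂ) (x : Phase) (t : ℝ) (n : ℤ) :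
    0 ≤ smearedGrad μ A x t n :=
  tsum_nonneg fun m => mul_nonneg (gradNorm_nonneg A x m) (profile_pos μ x t n m).le

theorem smearedGrad_le_exp_mul {μ : ℝ} (hμ : 0 < μ) {A : Phase → ℂ} (hA : IsClassOne A)
    (x : Phase) (t : ℝ) {n k : ℤ} (hnk : |(n : ℝ) - k| ≤ 1) :
    smearedGrad μ A x t n ≤ Real.exp μ * smearedGrad μ A x t k := by
  rw [smearedGrad, smearedGrad, ← tsum_mul_left]
  refine Summable.tsum_le_tsum (fun m => ?_) (summable_gradNorm_mul_profile hμ hA x t n)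
    ((summable_gradNorm_mul_profile hμ hA x t k).mul_left _)
  rw [mul_left_comm]
  exact mul_le_mul_of_nonneg_left (profile_le_exp_mul hμ x t hnk m) (gradNorm_nonneg A x m)

/-- On `ℓ^∞` the partial derivatives do not determine the Fréchet derivative, but the decay of `V`
places it in the closed span of the coordinate directions. -/
theorem norm_fderiv_linearizedFlow_le {μ : ℝ} (hμ : 0 < μ) {A : Phase → ℂ} (hA : IsClassOne A)
    (hdA : Differentiable ℝ A) {n : ℤ} {x e V : Phase} (he : IsUnitAt n e) {t : ℝ}
    (hV : HasLineDerivAt ℝ (todaFlow t) V x e) :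
    ‖fderiv ℝ A (todaFlow t x) V‖ ≤ 8 / todaRate * smearedGrad μ A x t n := by
  have hle := linearizedFlow_le hμ he hV
  have hκ : 0 ≤ 8 / todaRate := div_nonneg (by norm_num) todaRate_pos.le
  have hs := (summable_profile hμ x t n).mul_left (8 / todaRate)
  have hsum := (hasSum_dirA_add_dirB
    (hs.of_nonneg_of_le (fun _ => abs_nonneg _) fun m => (hle m).1)
    (hs.of_nonneg_of_le (fun _ => abs_nonneg _) fun m => (hle m).2)).mapL
      (fderiv ℝ A (todaFlow t x))
  rw [← hsum.tsum_eq, smearedGrad, ← tsum_mul_left]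
  refine tsum_of_norm_bounded
    ((summable_gradNorm_mul_profile hμ hA x t n).mul_left (8 / todaRate)).hasSum fun m => ?_
  have e1 : fderiv ℝ A (todaFlow t x) (dirA m) = partialA m A (todaFlow t x) :=
    (hdA _).lineDeriv_eq_fderiv.symm
  have e2 : fderiv ℝ A (todaFlow t x) (dirB m) = partialB m A (todaFlow t x) :=
    (hdA _).lineDeriv_eq_fderiv.symm
  rw [map_add, map_smul, map_smul, e1, e2]
  refine (norm_add_le _ _).trans ?_
  rw [norm_smul, norm_smul, Real.norm_eq_abs, Real.norm_eq_abs]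
  calc _ ≤ 8 / todaRate * profile μ x t n m * orbitNorm (partialA m A) x +
        8 / todaRate * profile μ x t n m * orbitNorm (partialB m A) x := by
        have := (profile_pos μ x t n m).le
        gcongr
        · exact (hle m).1
        · exact norm_todaFlow_le_orbitNorm (hA.bounded m).1 x t
        · exact (hle m).2
        · exact norm_todaFlow_le_orbitNorm (hA.bounded m).2 x t
    _ = _ := by rw [gradNorm]; ring

/-- Fréchet differentiability of `A` makes a directional derivative of the flow sufficient. -/
theorem hasLineDerivAt_todaDynamics {A : Phase → ℂ} (hdA : Differentiable ℝ A) {x e V : Phase}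
    {t : ℝ} (hV : HasLineDerivAt ℝ (todaFlow t) V x e) :
    HasLineDerivAt ℝ (todaDynamics t A) (fderiv ℝ A (todaFlow t x) V) x e :=
  (hdA (todaFlow t x)).hasFDerivAt.comp_hasDerivAt_of_eq 0 hV (by simp)

theorem lineDeriv_todaDynamics {μ : ℝ} (hμ : 0 < μ) {A : Phase → ℂ} (hA : IsClassOne A)
    (hdA : Differentiable ℝ A) {n : ℤ} (x : Phase) {e : Phase} (he : IsUnitAt n e) (t : ℝ) :
    LineDifferentiableAt ℝ (todaDynamics t A) x e ∧
      ‖lineDeriv ℝ (todaDynamics t A) x e‖ ≤ 8 / todaRate * smearedGrad μ A x t n := by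
  obtain ⟨V, hV⟩ := exists_tendsto_diffQuot x e t
  rw [← hasLineDerivAt_todaFlow_iff] at hV
  have h := hasLineDerivAt_todaDynamics hdA hV
  refine ⟨h.lineDifferentiableAt, ?_⟩
  rw [h.lineDeriv]
  exact norm_fderiv_linearizedFlow_le hμ hA hdA he hV

/-! ### The Lieb–Robinson bound -/

theorem lrTerm_eq (μ : ℝ) (A B : Phase → ℂ) (x : Phase) (t : ℝ) (n m : ℤ) :
    lrTerm μ (velocity μ x) A B x t (n, m) =
      gradNorm B x n * (gradNorm A x m * profile μ x t n m) := by
  rw [lrTerm, profile]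
  ring

theorem summable_lrTerm {μ : ℝ} (hμ : 0 < μ) {A B : Phase → ℂ} (hA : IsClassOne A)
    (hB : IsClassOne B) (x : Phase) (t : ℝ) : Summable (lrTerm μ (velocity μ x) A B x t) := by
  have h := ((hB.summable x).mul_of_nonneg (hA.summable x) (gradNorm_nonneg B x)
    (gradNorm_nonneg A x)).mul_right (Real.exp (μ * (velocity μ x * |t|)))
  refine h.of_nonneg_of_le (fun p => ?_) (fun p => ?_)
  · exact mul_nonneg (mul_nonneg (gradNorm_nonneg A x _) (gradNorm_nonneg B x _))
      (Real.exp_pos _).le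
  · rw [lrTerm_eq, ← mul_assoc]
    exact mul_le_mul_of_nonneg_left (profile_le hμ x t _ _)
      (mul_nonneg (gradNorm_nonneg B x _) (gradNorm_nonneg A x _))

theorem hasSum_gradNorm_mul_smearedGrad {μ : ℝ} (hμ : 0 < μ) {A B : Phase → ℂ}
    (hA : IsClassOne A) (hB : IsClassOne B) (x : Phase) (t : ℝ) :
    HasSum (fun n => gradNorm B x n * smearedGrad μ A x t n)
      (∑' p, lrTerm μ (velocity μ x) A B x t p) := by
  refine (summable_lrTerm hμ hA hB x t).hasSum.prod_fiberwise fun n => ?_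
  simp only [lrTerm_eq]
  exact (summable_gradNorm_mul_profile hμ hA x t n).hasSum.mul_left _

/-- Bound for the terms of the bracket, up to a constant; it splits into three shifted pieces. -/
theorem norm_bracketTerm_le {μ : ℝ} (hμ : 0 < μ) {A B : Phase → ℂ} (hA : IsClassOne A)
    (hB : IsClassOne B) (hdA : Differentiable ℝ A) (x : Phase) (t : ℝ) (n : ℤ) :
    ‖bracketTerm (todaDynamics t A) B x n‖ ≤ ‖x.1‖ * (8 / todaRate) *
      (Real.exp μ * (orbitNorm (partialB (n + 1) B) x * smearedGrad μ A x t (n + 1)) +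
        orbitNorm (partialB n B) x * smearedGrad μ A x t n +
        (1 + Real.exp μ) * (orbitNorm (partialA n B) x * smearedGrad μ A x t n)) := by
  set G := smearedGrad μ A x t with hG
  have hκ : 0 ≤ 8 / todaRate := div_nonneg (by norm_num) todaRate_pos.le
  have hG0 : ∀ k, 0 ≤ G k := smearedGrad_nonneg μ A x t
  have a0 := (lineDeriv_todaDynamics hμ hA hdA x (isUnitAt_dirA n) t).2
  have b0 := (lineDeriv_todaDynamics hμ hA hdA x (isUnitAt_dirB n) t).2
  have b1 := (lineDeriv_todaDynamics hμ hA hdA x (isUnitAt_dirB (n + 1)) t).2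
  have c0 := norm_le_orbitNorm (hB.bounded n).1 x
  have d0 := norm_le_orbitNorm (hB.bounded n).2 x
  have d1 := norm_le_orbitNorm (hB.bounded (n + 1)).2 x
  have c0' := orbitNorm_nonneg (partialA n B) x
  have d0' := orbitNorm_nonneg (partialB n B) x
  have d1' := orbitNorm_nonneg (partialB (n + 1) B) x
  have g1 : G n ≤ Real.exp μ * G (n + 1) :=
    smearedGrad_le_exp_mul hμ hA x t (by push_cast; norm_num)
  have g2 : G (n + 1) ≤ Real.exp μ * G n :=
    smearedGrad_le_exp_mul hμ hA x t (by push_cast; norm_num)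
  rw [bracketTerm, partialBTilde, partialBTilde, norm_mul, Complex.norm_real, Real.norm_eq_abs,
    mul_assoc ‖x.1‖]
  refine mul_le_mul (abs_apply_le x.1 n) ?_ (norm_nonneg _) (norm_nonneg _)
  refine (norm_sub_le _ _).trans ?_
  rw [norm_mul, norm_mul]
  calc _ ≤ 8 / todaRate * G n * (orbitNorm (partialB (n + 1) B) x + orbitNorm (partialB n B) x) +
        (8 / todaRate * G (n + 1) + 8 / todaRate * G n) * orbitNorm (partialA n B) x := by
        refine add_le_add (mul_le_mul a0 ((norm_sub_le _ _).trans (add_le_add d1 d0))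
          (norm_nonneg _) (mul_nonneg hκ (hG0 n))) (mul_le_mul ((norm_sub_le _ _).trans
          (add_le_add b1 b0)) c0 (norm_nonneg _) ?_)
        exact add_nonneg (mul_nonneg hκ (hG0 _)) (mul_nonneg hκ (hG0 n))
    _ = 8 / todaRate * (G n * orbitNorm (partialB (n + 1) B) x + G n * orbitNorm (partialB n B) x +
        (G (n + 1) + G n) * orbitNorm (partialA n B) x) := by ring
    -- Each derivative of `B` is paired with `G` at its own site; every move by one site costs `exp
    -- μ`.
    _ ≤ 8 / todaRate * (Real.exp μ * G (n + 1) * orbitNorm (partialB (n + 1) B) x +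
        G n * orbitNorm (partialB n B) x +
        (Real.exp μ * G n + G n) * orbitNorm (partialA n B) x) := by gcongr
    _ = _ := by ring

theorem bracket_todaDynamics_le {μ : ℝ} (hμ : 0 < μ) {A B : Phase → ℂ} (hA : IsClassOne A)
    (hB : IsClassOne B) (hdA : Differentiable ℝ A) (x : Phase) (t : ℝ) :
    Summable (bracketTerm (todaDynamics t A) B x) ∧
      ‖bracket (todaDynamics t A) B x‖ ≤
        lrConst μ * ‖x.1‖ * ∑' p, lrTerm μ (velocity μ x) A B x t p := by
  set G := smearedGrad μ A x t with hG
  have hG0 : ∀ k, 0 ≤ G k := smearedGrad_nonneg μ A x t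
  have hsum := hasSum_gradNorm_mul_smearedGrad hμ hA hB x t
  set S := ∑' p, lrTerm μ (velocity μ x) A B x t p with hS
  have hs1 : Summable fun n => orbitNorm (partialA n B) x * G n :=
    hsum.summable.of_nonneg_of_le (fun n => mul_nonneg (orbitNorm_nonneg _ _) (hG0 n))
      fun n => mul_le_mul_of_nonneg_right (le_add_of_nonneg_right (orbitNorm_nonneg _ _)) (hG0 n)
  have hs2 : Summable fun n => orbitNorm (partialB n B) x * G n :=
    hsum.summable.of_nonneg_of_le (fun n => mul_nonneg (orbitNorm_nonneg _ _) (hG0 n))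
      fun n => mul_le_mul_of_nonneg_right (le_add_of_nonneg_left (orbitNorm_nonneg _ _)) (hG0 n)
  have hs3 : HasSum (fun n => orbitNorm (partialB (n + 1) B) x * G (n + 1))
      (∑' n, orbitNorm (partialB n B) x * G n) :=
    (Equiv.addRight (1 : ℤ)).hasSum_iff.2 hs2.hasSum
  have hsplit : S = (∑' n, orbitNorm (partialA n B) x * G n) +
      ∑' n, orbitNorm (partialB n B) x * G n := by
    rw [← hsum.tsum_eq, ← hs1.tsum_add hs2]
    exact tsum_congr fun n => by rw [gradNorm, add_mul]
  have hbound := (((hs3.mul_left (Real.exp μ)).add hs2.hasSum).add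
    (hs1.hasSum.mul_left (1 + Real.exp μ))).mul_left (‖x.1‖ * (8 / todaRate))
  have hle := norm_bracketTerm_le hμ hA hB hdA x t
  refine ⟨Summable.of_norm_bounded hbound.summable hle, ?_⟩
  have hnorm := tsum_of_norm_bounded hbound hle
  have hS0 : 0 ≤ S := hsum.nonneg fun n => mul_nonneg (gradNorm_nonneg B x n) (hG0 n)
  rw [bracket, norm_mul]
  -- After reindexing, the `b` terms carry `exp μ + 1` in total, the same factor as the `a` terms,
  -- so they recombine to `S`.
  calc _ ≤ 1 / 4 * (‖x.1‖ * (8 / todaRate) * ((1 + Real.exp μ) * S)) := by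
        refine mul_le_mul (by norm_num) (hnorm.trans_eq ?_) (norm_nonneg _) (by norm_num)
        rw [hsplit]
        ring
    _ = 2 / todaRate * (1 + Real.exp μ) * ‖x.1‖ * S := by ring
    -- Only here is `1 + √17` weakened to `√17` in the denominator.
    _ ≤ _ := by
        rw [lrConst]
        have : 0 < Real.sqrt 17 := by positivity
        gcongr
        rw [todaRate]
        linarith

end Toda

end

theorem mainTheorem2 :
    -- The Toda equations are globally and uniquely solvable in `M`, so `Φ_t` is well defined.
    (∀ y : Toda.Phase, ∃! γ : ℝ → Toda.Phase, Toda.IsTodaSolution y γ) ∧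
    -- The Lieb–Robinson bound.
    ∀ (x : Toda.Phase) (μ : ℝ), 0 < μ →
      ∀ A B : Toda.Phase → ℂ, Toda.IsClassOne A → Toda.IsClassOne B → Differentiable ℝ A →
        ∀ t : ℝ,
          -- `{α_t(A), B}(x)` and the right-hand side are well defined.
          Toda.HasPartialsAt (Toda.todaDynamics t A) x ∧
          Summable (Toda.bracketTerm (Toda.todaDynamics t A) B x) ∧
          Summable (Toda.lrTerm μ (Toda.velocity μ x) A B x t) ∧
          ‖Toda.bracket (Toda.todaDynamics t A) B x‖ ≤
            Toda.lrConst μ * ‖x.1‖ *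
              ∑' p : ℤ × ℤ, Toda.lrTerm μ (Toda.velocity μ x) A B x t p := by
  refine ⟨Toda.existsUnique_todaSolution, fun x μ hμ A B hA hB hdA t => ?_⟩
  obtain ⟨h1, h2⟩ := Toda.bracket_todaDynamics_le hμ hA hB hdA x t
  exact ⟨fun n => ⟨(Toda.lineDeriv_todaDynamics hμ hA hdA x (Toda.isUnitAt_dirA n) t).1,
    (Toda.lineDeriv_todaDynamics hμ hA hdA x (Toda.isUnitAt_dirB n) t).1⟩, h1,
    Toda.summable_lrTerm hμ hA hB x t, h2⟩
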